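/- Let $p\ge 5$ be a prime and let $G$ be a primitive permutation group on a set $\Omega$ with $|\Omega|=3p$. Suppose that $G$ is of Type IV, that is, its permutation character is $\pi=1+\chi_1+\chi_2+\chi_3$, where $\chi_1,\chi_2,\chi_3$ are distinct non-principal irreducible complex characters of $G$ of degrees $p$, $p$, $p-1$ respectively. Let $\alpha\in\Omega$. The suborbits of $G$ are the orbits on $\Omega$ of the stabilizer $G_\alpha$, and the subdegrees are their lengths; suborbits $\Gamma,\Gamma'$ are paired if the corresponding orbits $\{(g\alpha,g\beta): g\in G,\ \beta\in\Gamma\}$ and $\{(g\alpha,g\beta): g\in G,\ \beta\in\Gamma'\}$ of $G$ on $\Omega\times\Omega$ are obtained from each other by reversing all pairs, and $\Gamma$ is self-paired if it is paired with itself. Then $p=3a^2+3a+1$ for some integer $a\ge 0$, and $G$ has exactly four suborbits, which can be labelled $\Delta_0=\{\alpha\},\Delta_1,\Delta_2,\Delta_3$, with lengths $n_0=1,n_1,n_2,n_3$, in such a way that the following holds. In case two different suborbits are paired, $\Delta_2$ and $\Delta_3$ are paired, and either (i) $a$ is even and $n_1=p-2a-1$, $n_2=n_3=p+a$; or (ii)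 $a$ is odd and $n_1=p+2a+1$, $n_2=n_3=p-a-1$. Otherwise all suborbits are self-paired, and (iii) $a$ is even and $n_1=p+2a+1$, $n_2=n_3=p-a-1$. -/

import Mathlib

namespace PrimitiveDegreeThreeP

/-- `χ : X → ℂ` is the character of an irreducible complex representation of `X` of finite
degree.  Every finite-dimensional complex representation is equivalent to one on some `ℂⁿ`. -/
def IsIrreducibleCharacter {X : Type*} [Group X] (χ : X → ℂ) : Prop :=
  ∃ (n : ℕ) (ρ : Representation ℂ X (Fin n → ℂ)), ρ.IsIrreducible ∧ χ = ρ.character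

variable {Ω : Type*} (G : Subgroup (Equiv.Perm Ω))

/-- The permutation character `π` of `G`: the number of points fixed by `g`. -/
noncomputable def permChar : G → ℂ :=
  fun g => ((MulAction.fixedBy Ω g).ncard : ℂ)

/-- `G` is of Type IV with respect to `p`: `π = 1 + χ₁ + χ₂ + χ₃`, where `χ₁`, `χ₂`, `χ₃` are
distinct non-principal irreducible characters, of degrees `p`, `p`, `p - 1` respectively
(the degree of `χ` is `χ 1`). -/
def IsTypeIV (p : ℕ) : Prop :=
  ∃ χ₁ χ₂ χ₃ : G → ℂ,
    IsIrreducibleCharacter χ₁ ∧ IsIrreducibleCharacter χ₂ ∧ IsIrreducibleCharacter χ₃ ∧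
    χ₁ ≠ 1 ∧ χ₂ ≠ 1 ∧ χ₃ ≠ 1 ∧ χ₁ ≠ χ₂ ∧ χ₁ ≠ χ₃ ∧ χ₂ ≠ χ₃ ∧
    χ₁ 1 = (p : ℂ) ∧ χ₂ 1 = (p : ℂ) ∧ χ₃ 1 = (p : ℂ) - 1 ∧
    permChar G = 1 + χ₁ + χ₂ + χ₃

/-- The suborbits of `G` with respect to the point `α`: the orbits on `Ω` of the stabilizer of
`α` in `G`.  The subdegrees are their cardinalities. -/
def suborbits (α : Ω) : Set (Set Ω) :=
  {S | ∃ β : Ω, S = MulAction.orbit (MulAction.stabilizer G α) β}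

/-- The `G`-invariant subset of `Ω × Ω` corresponding to a set `S` of points: all the pairs
`(g α, g β)` with `g ∈ G` and `β ∈ S`.  If `S` is a suborbit with respect to `α`, this is the
corresponding orbit of `G` on `Ω × Ω`. -/
def orbital (α : Ω) (S : Set Ω) : Set (Ω × Ω) :=
  {x | ∃ g : G, ∃ β ∈ S, x = (g • α, g • β)}

/-- The suborbits `S` and `T` are paired: the orbit of `G` on `Ω × Ω` corresponding to `T` is
obtained from the one corresponding to `S` by reversing all pairs. -/
def IsPaired (α : Ω) (S T : Set Ω) : Prop :=
  orbital G α T = {x | (x.2, x.1) ∈ orbital G α S}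

end PrimitiveDegreeThreeP

/-! The permutation character is multiplicity-free with four constituents, so G has rank 4 and the
adjacency matrices of its four orbitals are simultaneously diagonalizable, with eigenvalues n, θ, φ,
ψ of multiplicities 1, p, p, p - 1. Conjugate eigenvalues have equal multiplicities, which makes ψ
an integer; the trace then makes θ + φ an integer and gives n = ψ + pk for a nontrivial orbital.
Primitivity yields k ≠ 0, and the three values of k add up to 3. Traces of products of two matrices
determine the products of the differences θ - φ; traces of products of three give divisibilities,
because intersection numbers are integers.

If two suborbits are paired, all k equal 1. On the paired orbitals θ - φ is nonzero and purely
imaginary, on the third it is real, and the product of the two is real, so the third difference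
vanishes. This gives p = 3y² + 3y + 1 with y = ψ 2, and one cubic trace makes y even. The sign of y
separates (i) from (ii) (`Parameters.exists_eq_of_inv_swap`).

If all suborbits are self-paired, there is a contradiction, so (iii) holds vacuously
(`Parameters.false_of_inv_eq`). Again every k is 1; with p = 2r + 1 the subdegrees are 2(r + x), 2(r
+ y), 2(r + z), where x + y + z = 1, x, y, z satisfy a cubic relation and are of size O(√r), and the
traces give six divisibilities. Let S be the product of r + x, r + y, r + z, let D be the product of
the differences of x, y, z, and let W be `defect`. Prime by prime, S² divides r²D²W
(`sq_dvd_bound`), while the AM-GM inequality gives r³D² ≤ S² (`cube_mul_sq_le`). If x, y, z are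
distinct, then r ≤ |W|, but W is only O(√r), and finitely many cases remain. Two equal values are
excluded by parity (`false_of_eq`). -/

namespace PrimitiveDegreeThreeP

/-! ### Self-paired case: divisibility of `bound`, prime by prime -/

/-- Arithmetic constraints on integers `x`, `y`, `z`, where `2 * (r + x)`, `2 * (r + y)`,
`2 * (r + z)` are to be subdegrees of a group of degree `3 * (2 * r + 1)`. -/
structure IsAdmissible (r x y z : ℤ) : Prop where
  sum_eq : x + y + z = 1
  eq_zero : r ^ 2 + 2 * r * (x * y + y * z + z * x) + 3 * (x * y * z) = 0
  dvd_xy : r + x ∣ x * (4 * x - 1) * (3 * y - 1)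
  dvd_xz : r + x ∣ x * (4 * x - 1) * (3 * z - 1)
  dvd_yx : r + y ∣ y * (4 * y - 1) * (3 * x - 1)
  dvd_yz : r + y ∣ y * (4 * y - 1) * (3 * z - 1)
  dvd_zx : r + z ∣ z * (4 * z - 1) * (3 * x - 1)
  dvd_zy : r + z ∣ z * (4 * z - 1) * (3 * y - 1)

namespace IsAdmissible

variable {r x y z : ℤ}

theorem swap (h : IsAdmissible r x y z) : IsAdmissible r y x z where
  sum_eq := by linarith [h.sum_eq]
  eq_zero := by linarith [h.eq_zero]
  dvd_xy := h.dvd_yx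
  dvd_xz := h.dvd_yz
  dvd_yx := h.dvd_xy
  dvd_yz := h.dvd_xz
  dvd_zx := h.dvd_zy
  dvd_zy := h.dvd_zx

theorem rotate (h : IsAdmissible r x y z) : IsAdmissible r y z x where
  sum_eq := by linarith [h.sum_eq]
  eq_zero := by linarith [h.eq_zero]
  dvd_xy := h.dvd_yz
  dvd_xz := h.dvd_yx
  dvd_yx := h.dvd_zy
  dvd_yz := h.dvd_zx
  dvd_zx := h.dvd_xy
  dvd_zy := h.dvd_xz

/-- The possible reasons for a prime power `l ^ a` to divide `r + x`. -/
theorem prime_pow_dvd_cases (h : IsAdmissible r x y z) {l : ℤ} (hl : Prime l) {a : ℕ}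
    (ha : a ≠ 0) (hd : l ^ a ∣ r + x) :
    (l ∣ x ∧ l ^ a ∣ x ∧ l ^ a ∣ r) ∨
    (¬ l ∣ x ∧ l ∣ 4 * x - 1 ∧ ¬ l ∣ 3 * x - 1 ∧ l ^ a ∣ 4 * x - 1 ∧
      ((l ^ a ∣ x - y ∧ ¬ l ∣ x - z) ∨ (l ^ a ∣ x - z ∧ ¬ l ∣ x - y))) ∨
    (¬ l ∣ x ∧ l ∣ 3 * x - 1 ∧ l ^ a ∣ x - y ∧ l ^ a ∣ x - z) := by
  have hs := h.sum_eq
  have hxy : l ^ a ∣ x * (4 * x - 1) * (3 * y - 1) := hd.trans h.dvd_xy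
  have hxz : l ^ a ∣ x * (4 * x - 1) * (3 * z - 1) := hd.trans h.dvd_xz
  -- Putting r = -x and y + z = 1 - x in `eq_zero` leaves exactly x(x - y)(x - z), so this product
  -- vanishes modulo r + x.
  have hdiff : l ^ a ∣ x * ((x - y) * (x - z)) := by
    have : x * ((x - y) * (x - z)) =
        (r + x) * -((r + x) + 2 * (y * z - x ^ 2)) := by
      obtain rfl : z = 1 - x - y := by linarith
      linear_combination h.eq_zero
    rw [this]
    exact hd.mul_right _
  have hone : ¬ l ∣ 1 := fun h1 => hl.not_isUnit (isUnit_of_dvd_one h1)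
  have hla : l ∣ l ^ a := dvd_pow_self l ha
  by_cases hx : l ∣ x
  · left
    have h4 : ¬ l ∣ 4 * x - 1 := fun h4 => hone (by
      have := dvd_sub (hx.mul_left 4) h4
      simpa using this)
    have hyz : ¬ (l ∣ 3 * y - 1 ∧ l ∣ 3 * z - 1) := fun ⟨h1, h2⟩ => hone (by
      have := dvd_add (dvd_add h1 h2) (hx.mul_left 3)
      rwa [show 3 * y - 1 + (3 * z - 1) + 3 * x = 1 by linarith] at this)
    have hx' : l ^ a ∣ x := by
      by_cases h1 : l ∣ 3 * y - 1
      · have h2 : ¬ l ∣ 3 * z - 1 := fun h2 => hyz ⟨h1, h2⟩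
        exact hl.pow_dvd_of_dvd_mul_right a h4 (hl.pow_dvd_of_dvd_mul_right a h2 hxz)
      · exact hl.pow_dvd_of_dvd_mul_right a h4 (hl.pow_dvd_of_dvd_mul_right a h1 hxy)
    exact ⟨hx, hx', by simpa using dvd_sub hd hx'⟩
  right
  have hxy' : l ^ a ∣ (4 * x - 1) * (3 * y - 1) :=
    hl.pow_dvd_of_dvd_mul_left a hx (by rwa [mul_assoc] at hxy)
  have hxz' : l ^ a ∣ (4 * x - 1) * (3 * z - 1) :=
    hl.pow_dvd_of_dvd_mul_left a hx (by rwa [mul_assoc] at hxz)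
  have hdiff' := hl.pow_dvd_of_dvd_mul_left a hx hdiff
  by_cases h4 : l ∣ 4 * x - 1
  · left
    have h3 : ¬ l ∣ 3 * x - 1 := fun h3 => hx (by
      have := dvd_sub h4 h3
      rwa [show 4 * x - 1 - (3 * x - 1) = x by ring] at this)
    refine ⟨hx, h4, h3, ?_, ?_⟩
    · by_cases h1 : l ∣ 3 * y - 1
      · have h2 : ¬ l ∣ 3 * z - 1 := fun h2 => h3 (by
          have := dvd_add h1 h2
          rwa [show 3 * y - 1 + (3 * z - 1) = -(3 * x - 1) by linarith, dvd_neg] at this)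
        exact hl.pow_dvd_of_dvd_mul_right a h2 hxz'
      · exact hl.pow_dvd_of_dvd_mul_right a h1 hxy'
    · by_cases h1 : l ∣ x - z
      · have h2 : ¬ l ∣ x - y := fun h2 => h3 (by
          have := dvd_add h1 h2
          rwa [show x - z + (x - y) = 3 * x - 1 by linarith] at this)
        exact Or.inr ⟨hl.pow_dvd_of_dvd_mul_left a h2 hdiff', h2⟩
      · exact Or.inl ⟨hl.pow_dvd_of_dvd_mul_right a h1 hdiff', h1⟩
  · right
    have hy := hl.pow_dvd_of_dvd_mul_left a h4 hxy'
    have hz := hl.pow_dvd_of_dvd_mul_left a h4 hxz'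
    have hx3 : l ^ a ∣ 3 * x - 1 := by
      have := dvd_add hy hz
      rwa [show 3 * y - 1 + (3 * z - 1) = -(3 * x - 1) by linarith, dvd_neg] at this
    have h3 : ¬ l ∣ 3 := fun h3 => hone (by
      have := dvd_sub (h3.mul_right x) (hla.trans hx3)
      simpa using this)
    refine ⟨hx, hla.trans hx3, hl.pow_dvd_of_dvd_mul_left a h3 ?_,
      hl.pow_dvd_of_dvd_mul_left a h3 ?_⟩
    · have := dvd_sub hx3 hy
      rwa [show 3 * x - 1 - (3 * y - 1) = 3 * (x - y) by ring] at this
    · have := dvd_sub hx3 hz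
      rwa [show 3 * x - 1 - (3 * z - 1) = 3 * (x - z) by ring] at this

/-- The quantity `W` with `3 (4x - 1) (4y - 1) (4z - 1) = - (8r + 3) W`. -/
def defect (r x y z : ℤ) : ℤ := 8 * r + 16 * (x * y + y * z + z * x) - 3

/-- Expanding the product in elementary symmetric functions and eliminating xyz by `eq_zero` makes
8r + 3 split off. At a prime dividing r + x and 4x - 1 the factor 8r + 3 is a unit, so the powers
dividing 4x - 1 and 4y - 1 both pass to `defect`. -/
theorem defect_mul (h : IsAdmissible r x y z) :
    3 * ((4 * x - 1) * (4 * y - 1) * (4 * z - 1)) = -(8 * r + 3) * defect r x y z := by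
  obtain rfl : z = 1 - x - y := by linarith [h.sum_eq]
  unfold defect
  linear_combination 64 * h.eq_zero

/-- This controls the size of `defect`: since x, y, z are O(√r), the right side is O(r^(3/2)). -/
theorem mul_defect (h : IsAdmissible r x y z) :
    r * defect r x y z = -3 * (8 * (x * y * z) + r) := by
  unfold defect
  linear_combination 8 * h.eq_zero

/-- The square of the discriminant-type product to be compared with the product of subdegrees. -/
def bound (r x y z : ℤ) : ℤ :=
  r ^ 2 * ((x - y) * (y - z) * (z - x)) ^ 2 * defect r x y z

theorem bound_swap : bound r y x z = bound r x y z := by unfold bound defect; ring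

theorem bound_rotate : bound r y z x = bound r x y z := by unfold bound defect; ring

variable {l : ℤ} {a b c : ℕ}

/-- The larger of the two powers is taken from r and the smaller from x - y. -/
theorem pow_dvd_bound_of_dvd (ha : l ^ a ∣ x) (hra : l ^ a ∣ r) (hb : l ^ b ∣ y)
    (hrb : l ^ b ∣ r) : l ^ (2 * (a + b)) ∣ bound r x y z := by
  have key : l ^ (a + b) ∣ r * ((x - y) * (y - z) * (z - x)) := by
    rcases le_total a b with hab | hab
    · have h1 : l ^ a ∣ x - y := dvd_sub ha ((pow_dvd_pow l hab).trans hb)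
      rw [add_comm, pow_add]
      exact mul_dvd_mul hrb ((h1.mul_right _).mul_right _)
    · have h1 : l ^ b ∣ x - y := dvd_sub ((pow_dvd_pow l hab).trans ha) hb
      rw [pow_add]
      exact mul_dvd_mul hra ((h1.mul_right _).mul_right _)
  have := pow_dvd_pow_of_dvd key 2
  rw [← pow_mul, mul_comm _ 2, mul_pow] at this
  exact this.mul_right _

theorem dvd_add_of_dvd_sub {m : ℤ} (h : m ∣ r + x) (h' : m ∣ x - y) : m ∣ r + y := by
  have := dvd_sub h h'
  rwa [show r + x - (x - y) = r + y by ring] at this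

theorem not_dvd_one (hl : Prime l) : ¬ l ∣ 1 :=
  fun h1 => hl.not_isUnit (isUnit_of_dvd_one h1)

theorem le_of_pow_dvd {w : ℤ} {m n : ℕ} (h : l ^ n ∣ w) (h' : ¬ l ^ (m + 1) ∣ w) : n ≤ m := by
  by_contra hn
  exact h' ((pow_dvd_pow l (by omega)).trans h)

/-- The case where `l` divides `x` and `r`. -/
theorem pow_dvd_bound_of_dvd_left (h : IsAdmissible r x y z) (hl : Prime l) (ha0 : a ≠ 0)
    (hx : l ^ a ∣ x) (hr : l ^ a ∣ r) (hb : l ^ b ∣ r + y) (hc : l ^ c ∣ r + z) :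
    l ^ (2 * (a + b + c)) ∣ bound r x y z := by
  have hx' : l ∣ x := (dvd_pow_self l ha0).trans hx
  have hr' : l ∣ r := (dvd_pow_self l ha0).trans hr
  have hfin : ∀ {y z : ℤ} {b : ℕ}, IsAdmissible r y z x → l ^ b ∣ r + y → b ≠ 0 →
      l ^ b ∣ y ∧ l ^ b ∣ r := by
    intro y z b h' hb hb0
    have hy : l ∣ y := (dvd_add_right hr').1 ((dvd_pow_self l hb0).trans hb)
    rcases h'.prime_pow_dvd_cases hl hb0 hb with h1 | h1 | h1
    · exact h1.2
    · exact absurd hy h1.1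
    · exact absurd hy h1.1
  rcases eq_or_ne b 0 with rfl | hb0
  · rcases eq_or_ne c 0 with rfl | hc0
    · simpa using pow_dvd_bound_of_dvd (z := z) (b := 0) (y := y) hx hr (by simp) (by simp)
    · obtain ⟨h1, h2⟩ := hfin h.swap.rotate.rotate hc hc0
      have := pow_dvd_bound_of_dvd (z := y) hx hr h1 h2
      rw [bound_swap, bound_rotate, bound_rotate] at this
      simpa using this
  · obtain ⟨h1, h2⟩ := hfin h.rotate hb hb0
    -- Because x + y + z = 1, the prime cannot divide all three.
    have hc0 : c = 0 := by
      by_contra hc0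
      have hy : l ∣ y := (dvd_pow_self l hb0).trans h1
      have hz : l ∣ z := (dvd_add_right hr').1 ((dvd_pow_self l hc0).trans hc)
      exact not_dvd_one hl (h.sum_eq ▸ dvd_add (dvd_add hx' hy) hz)
    subst hc0
    simpa using pow_dvd_bound_of_dvd (z := z) hx hr h1 h2

/-- The case where `l` divides none of `x`, `y`, `z` but divides `3x - 1`. -/
theorem pow_dvd_bound_of_dvd_three_mul_sub_one (h : IsAdmissible r x y z) (hl : Prime l)
    (ha0 : a ≠ 0) (h3 : l ∣ 3 * x - 1) (hxy : l ^ a ∣ x - y) (hxz : l ^ a ∣ x - z)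
    (hda : l ^ a ∣ r + x) (hna : ¬ l ^ (a + 1) ∣ r + x)
    (hb : l ^ b ∣ r + y) (hnb : ¬ l ^ (b + 1) ∣ r + y)
    (hc : l ^ c ∣ r + z) (hnc : ¬ l ^ (c + 1) ∣ r + z) :
    l ^ (2 * (a + b + c)) ∣ bound r x y z := by
  have hla := dvd_pow_self l ha0
  -- The congruence x ≡ y passes l ^ a from r + x to r + y and, in the other direction, l ^ b from r
  -- + y to r + x. So all exponents agree, and each of the three differences contributes one full
  -- power.
  have hfin : ∀ {y z : ℤ} {b : ℕ}, IsAdmissible r y z x → l ^ a ∣ x - y → l ^ b ∣ r + y →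
      ¬ l ^ (b + 1) ∣ r + y → b = a := by
    intro y z b h' hxy hb hnb
    have hab : a ≤ b := le_of_pow_dvd (dvd_add_of_dvd_sub hda hxy) hnb
    have h3y : l ∣ 3 * y - 1 := by
      have := dvd_sub h3 ((hla.trans hxy).mul_left 3)
      rwa [show 3 * x - 1 - 3 * (x - y) = 3 * y - 1 by ring] at this
    refine le_antisymm ?_ hab
    rcases h'.prime_pow_dvd_cases hl (by omega) hb with h1 | h1 | h1
    · refine absurd ?_ (not_dvd_one hl)
      simpa using dvd_sub (h1.1.mul_left 3) h3y
    · exact absurd h3y h1.2.2.1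
    · exact le_of_pow_dvd (dvd_add_of_dvd_sub hb h1.2.2.2) hna
  have hba : b = a := hfin h.rotate hxy hb hnb
  have hca : c = a := hfin h.swap.rotate.rotate hxz hc hnc
  subst hba hca
  have hyz : l ^ c ∣ y - z := by simpa using dvd_sub hxz hxy
  have hzx : l ^ c ∣ z - x := by simpa using dvd_neg.2 hxz
  have := pow_dvd_pow_of_dvd (mul_dvd_mul (mul_dvd_mul hxy hyz) hzx) 2
  unfold bound
  refine Dvd.dvd.mul_right (Dvd.dvd.mul_left ?_ _) _
  rwa [← pow_add, ← pow_add, ← pow_mul, mul_comm _ 2] at this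

/-- The case where `l` divides `4x - 1` and `x - y`. -/
theorem pow_dvd_bound_of_dvd_four_mul_sub_one (h : IsAdmissible r x y z) (hl : Prime l)
    (ha0 : a ≠ 0) (hx : ¬ l ∣ x) (h4 : l ^ a ∣ 4 * x - 1) (hxy : l ^ a ∣ x - y)
    (hxz : ¬ l ∣ x - z) (hda : l ^ a ∣ r + x) (hna : ¬ l ^ (a + 1) ∣ r + x)
    (hb : l ^ b ∣ r + y) (hnb : ¬ l ^ (b + 1) ∣ r + y) (hc : l ^ c ∣ r + z) :
    l ^ (2 * (a + b + c)) ∣ bound r x y z := by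
  have hla := dvd_pow_self l ha0
  have hc0 : c = 0 := by
    by_contra hc0
    refine hxz ?_
    simpa using dvd_sub (hla.trans hda) ((dvd_pow_self l hc0).trans hc)
  have h4y : l ^ a ∣ 4 * y - 1 := by
    have := dvd_sub h4 (hxy.mul_left 4)
    rwa [show 4 * x - 1 - 4 * (x - y) = 4 * y - 1 by ring] at this
  have hab : a ≤ b := le_of_pow_dvd (dvd_add_of_dvd_sub hda hxy) hnb
  have hba : b ≤ a := by
    rcases h.rotate.prime_pow_dvd_cases hl (by omega) hb with h1 | h1 | h1
    · refine absurd ?_ (not_dvd_one hl)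
      simpa using dvd_sub (h1.1.mul_left 4) (hla.trans h4y)
    · rcases h1.2.2.2.2 with h2 | h2
      · exact absurd ((dvd_sub_comm).1 (hla.trans hxy)) h2.2
      · exact le_of_pow_dvd (dvd_add_of_dvd_sub hb h2.1) hna
    · refine absurd ?_ h1.1
      have := dvd_sub (hla.trans h4y) h1.2.1
      rwa [show 4 * y - 1 - (3 * y - 1) = y by ring] at this
  obtain rfl : b = a := le_antisymm hba hab
  subst hc0
  have hW : l ^ (2 * b) ∣ defect r x y z := by
    have h1 : l ^ (2 * b) ∣ -(8 * r + 3) * defect r x y z := by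
      rw [← h.defect_mul, two_mul, pow_add]
      exact ((mul_dvd_mul h4 h4y).mul_right _).mul_left _
    refine hl.pow_dvd_of_dvd_mul_left _ (fun h8 => not_dvd_one hl ?_) h1
    -- 8r + 3 = 1 + 8(r + x) - 2(4x - 1) is congruent to 1 modulo l.
    have := dvd_add (dvd_sub (dvd_neg.1 h8 |> fun h => by simpa using h)
      ((hla.trans hda).mul_left 8)) ((hla.trans h4).mul_left 2)
    rwa [show 8 * r + 3 - 8 * (r + x) + 2 * (4 * x - 1) = 1 by ring] at this
  unfold bound
  -- Half of the exponent comes from (x - y)² and half from `defect`.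
  rw [show 2 * (b + b + 0) = b * 2 + 2 * b by ring, pow_add]
  refine mul_dvd_mul (Dvd.dvd.mul_left ?_ _) hW
  rw [pow_mul]
  exact pow_dvd_pow_of_dvd ((hxy.mul_right _).mul_right _) 2

theorem pow_dvd_bound_of_ne_zero (h : IsAdmissible r x y z) (hl : Prime l) (ha0 : a ≠ 0)
    (hda : l ^ a ∣ r + x) (hna : ¬ l ^ (a + 1) ∣ r + x)
    (hb : l ^ b ∣ r + y) (hnb : ¬ l ^ (b + 1) ∣ r + y)
    (hc : l ^ c ∣ r + z) (hnc : ¬ l ^ (c + 1) ∣ r + z) :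
    l ^ (2 * (a + b + c)) ∣ bound r x y z := by
  rcases h.prime_pow_dvd_cases hl ha0 hda with h1 | ⟨hx, -, -, h4, h1 | h1⟩ | h1
  · exact h.pow_dvd_bound_of_dvd_left hl ha0 h1.2.1 h1.2.2 hb hc
  · exact h.pow_dvd_bound_of_dvd_four_mul_sub_one hl ha0 hx h4 h1.1 h1.2 hda hna hb hnb hc
  · have := h.rotate.rotate.swap.pow_dvd_bound_of_dvd_four_mul_sub_one hl ha0 hx h4 h1.1 h1.2 hda
      hna hc hnc hb
    rwa [bound_swap, ← bound_rotate, add_right_comm] at this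
  · exact h.pow_dvd_bound_of_dvd_three_mul_sub_one hl ha0 h1.2.1 h1.2.2.1 h1.2.2.2 hda hna hb hnb
      hc hnc

theorem pow_dvd_bound (h : IsAdmissible r x y z) (hl : Prime l)
    (hda : l ^ a ∣ r + x) (hna : ¬ l ^ (a + 1) ∣ r + x)
    (hb : l ^ b ∣ r + y) (hnb : ¬ l ^ (b + 1) ∣ r + y)
    (hc : l ^ c ∣ r + z) (hnc : ¬ l ^ (c + 1) ∣ r + z) :
    l ^ (2 * (a + b + c)) ∣ bound r x y z := by
  rcases ne_or_eq a 0 with ha | rfl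
  · exact h.pow_dvd_bound_of_ne_zero hl ha hda hna hb hnb hc hnc
  rcases ne_or_eq b 0 with hb0 | rfl
  · have := h.rotate.pow_dvd_bound_of_ne_zero hl hb0 hb hnb hc hnc hda hna
    rwa [bound_rotate, show b + c + 0 = 0 + b + c by ring] at this
  rcases ne_or_eq c 0 with hc0 | rfl
  · have := h.rotate.rotate.pow_dvd_bound_of_ne_zero hl hc0 hc hnc hda hna hb hnb
    rwa [bound_rotate, bound_rotate, show c + 0 + 0 = 0 + 0 + c by ring] at this
  · simp

theorem sq_dvd_bound (h : IsAdmissible r x y z) (hx : r + x ≠ 0) (hy : r + y ≠ 0)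
    (hz : r + z ≠ 0) : ((r + x) * (r + y) * (r + z)) ^ 2 ∣ bound r x y z := by
  rw [← Int.natAbs_dvd_natAbs, Nat.dvd_iff_prime_pow_dvd_dvd]
  intro l k hl hk
  have hl' : Prime (l : ℤ) := Nat.prime_iff_prime_int.1 hl
  have hex : ∀ w : ℤ, w ≠ 0 → ∃ a : ℕ, (l : ℤ) ^ a ∣ w ∧ ¬ (l : ℤ) ^ (a + 1) ∣ w ∧
      ∃ u, ¬ (l : ℤ) ∣ u ∧ w = (l : ℤ) ^ a * u := by
    intro w hw
    obtain ⟨a, u, hu, rfl⟩ := (FiniteMultiplicity.of_prime_left hl' hw).exists_eq_pow_mul_and_not_dvd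
      |> fun ⟨u, h1, h2⟩ => (⟨_, u, h2, h1⟩ : ∃ a : ℕ, ∃ u : ℤ, ¬ (l : ℤ) ∣ u ∧ w = (l : ℤ) ^ a * u)
    refine ⟨a, Dvd.intro _ rfl, fun h => hu ?_, u, hu, rfl⟩
    rw [pow_succ] at h
    exact (mul_dvd_mul_iff_left (pow_ne_zero _ hl'.ne_zero)).1 h
  obtain ⟨a, ha, hna, u, hu, hxu⟩ := hex _ hx
  obtain ⟨b, hb, hnb, v, hv, hyv⟩ := hex _ hy
  obtain ⟨c, hc, hnc, w, hw, hzw⟩ := hex _ hz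
  have hmain := h.pow_dvd_bound hl' ha hna hb hnb hc hnc
  rw [← Int.natCast_dvd] at hk ⊢
  refine dvd_trans ?_ hmain
  push_cast at hk ⊢
  rw [hxu, hyv, hzw, show ((l : ℤ) ^ a * u * ((l : ℤ) ^ b * v) * ((l : ℤ) ^ c * w)) ^ 2 =
    (l : ℤ) ^ (2 * (a + b + c)) * (u * v * w) ^ 2 by ring] at hk
  refine hl'.pow_dvd_of_dvd_mul_right k (fun h1 => ?_) hk
  rcases hl'.dvd_or_dvd (hl'.dvd_of_dvd_pow h1) with h2 | h2
  · exact (hl'.dvd_or_dvd h2).elim hu hv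
  · exact hw h2

end IsAdmissible
end PrimitiveDegreeThreeP

/-! ### Self-paired case: size estimates and the contradiction -/

namespace PrimitiveDegreeThreeP
namespace IsAdmissible
variable {r x y z : ℤ}

theorem cube_amgm {a b c : ℤ} (ha : 0 ≤ a) (hb : 0 ≤ b) (hc : 0 ≤ c) :
    27 * (a * b * c) ≤ (a + b + c) ^ 3 := by
  nlinarith [mul_nonneg ha (sq_nonneg (b - c)), mul_nonneg hb (sq_nonneg (c - a)),
    mul_nonneg hc (sq_nonneg (a - b)), mul_nonneg (add_nonneg (add_nonneg ha hb) hc)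
      (add_nonneg (add_nonneg (sq_nonneg (a - b)) (sq_nonneg (b - c))) (sq_nonneg (c - a)))]

/-- AM-GM for the weighted squares (r + z)(x - y)², (r + x)(y - z)², (r + y)(z - x)². By `eq_zero`
they add up to the second elementary symmetric function of r + x, r + y, r + z, and r times that
function is three times their product. -/
theorem cube_mul_sq_le (h : IsAdmissible r x y z) (hx : 0 < r + x)
    (hy : 0 < r + y) (hz : 0 < r + z) :
    r ^ 3 * ((x - y) * (y - z) * (z - x)) ^ 2 ≤ ((r + x) * (r + y) * (r + z)) ^ 2 := by
  have hsum : (r + z) * (x - y) ^ 2 + (r + x) * (y - z) ^ 2 + (r + y) * (z - x) ^ 2 =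
      (r + x) * (r + y) + (r + y) * (r + z) + (r + z) * (r + x) := by
    obtain rfl : z = 1 - x - y := by linarith [h.sum_eq]
    linear_combination -3 * h.eq_zero
  have hprod : r * ((r + x) * (r + y) + (r + y) * (r + z) + (r + z) * (r + x)) =
      3 * ((r + x) * (r + y) * (r + z)) := by
    obtain rfl : z = 1 - x - y := by linarith [h.sum_eq]
    linear_combination -h.eq_zero
  have hr : 0 ≤ r := by
    by_contra hr
    have := h.sum_eq
    have h1 : 0 < (r + x) * (r + y) * (r + z) := by positivity
    have h2 : 0 < (r + x) * (r + y) + (r + y) * (r + z) + (r + z) * (r + x) := by positivity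
    nlinarith
  set s := (r + x) * (r + y) * (r + z) with hs
  have hs0 : 0 < s := by positivity
  have := cube_amgm (mul_nonneg hz.le (sq_nonneg (x - y))) (mul_nonneg hx.le (sq_nonneg (y - z)))
    (mul_nonneg hy.le (sq_nonneg (z - x)))
  rw [hsum] at this
  have h3 := mul_le_mul_of_nonneg_left this (pow_nonneg hr 3)
  rw [← mul_pow, hprod] at h3
  refine le_of_mul_le_mul_left ?_ hs0
  linarith [show r ^ 3 * (27 * ((r + z) * (x - y) ^ 2 * ((r + x) * (y - z) ^ 2) *
    ((r + y) * (z - x) ^ 2))) = 27 * (s * (r ^ 3 * ((x - y) * (y - z) * (z - x)) ^ 2)) by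
      rw [hs]; ring, show (3 * s) ^ 3 = 27 * (s * s ^ 2) by ring]

theorem defect_ne_zero (h : IsAdmissible r x y z) : defect r x y z ≠ 0 := by
  intro h0
  have h1 := h.defect_mul
  rw [h0, mul_zero] at h1
  -- No factor 4t - 1 with t an integer can be zero.
  rcases mul_eq_zero.1 h1 with h2 | h2
  · omega
  · rcases mul_eq_zero.1 h2 with h2 | h2
    · rcases mul_eq_zero.1 h2 with h2 | h2 <;> omega
    · omega

/-- `sq_dvd_bound` and `cube_mul_sq_le` squeeze: S² ≤ r²D²|W| and r³D² ≤ S². Distinctness makes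
`bound` nonzero, so that divisibility becomes an inequality. -/
theorem le_abs_defect (h : IsAdmissible r x y z) (hr : 0 < r) (hx : 0 < r + x)
    (hy : 0 < r + y) (hz : 0 < r + z) (hxy : x ≠ y) (hyz : y ≠ z) (hzx : z ≠ x) :
    r ≤ |defect r x y z| := by
  have hd : bound r x y z ≠ 0 := by
    unfold bound
    refine mul_ne_zero (mul_ne_zero (pow_ne_zero _ hr.ne') (pow_ne_zero _ ?_)) h.defect_ne_zero
    exact mul_ne_zero (mul_ne_zero (sub_ne_zero.2 hxy) (sub_ne_zero.2 hyz)) (sub_ne_zero.2 hzx)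
  have h1 := Int.le_of_dvd (abs_pos.2 hd) ((dvd_abs _ _).2 (h.sq_dvd_bound hx.ne' hy.ne' hz.ne'))
  have h2 := h.cube_mul_sq_le hx hy hz
  unfold bound at h1
  rw [abs_mul, abs_mul, abs_of_pos (pow_pos hr 2), abs_of_nonneg (sq_nonneg _)] at h1
  set s := ((r + x) * (r + y) * (r + z)) ^ 2 with hs
  have hs0 : 0 < s := by positivity
  refine le_of_mul_le_mul_left ?_ hs0
  calc s * r ≤ r ^ 2 * ((x - y) * (y - z) * (z - x)) ^ 2 * |defect r x y z| * r :=
        mul_le_mul_of_nonneg_right h1 hr.le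
    _ = r ^ 3 * ((x - y) * (y - z) * (z - x)) ^ 2 * |defect r x y z| := by ring
    _ ≤ s * |defect r x y z| := mul_le_mul_of_nonneg_right h2 (abs_nonneg _)

theorem lt_twenty_of_mul_nonneg (h : IsAdmissible r x y z) (hr : 0 < r)
    (hW : r ≤ |defect r x y z|) (hx : 3 * x ^ 2 - 3 * x ≤ 2 * r) (hyz : 0 ≤ y * z) : r < 20 := by
  have h1 : r ^ 2 ≤ |r * defect r x y z| := by
    rw [abs_mul, abs_of_pos hr, sq]
    exact mul_le_mul_of_nonneg_left hW hr.le
  rw [h.mul_defect, abs_mul] at h1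
  have h2 : |8 * (x * y * z) + r| ≤ 8 * (|x| * (y * z)) + r := by
    refine (abs_add_le _ _).trans ?_
    rw [abs_of_pos hr, abs_mul, mul_assoc x, abs_mul, abs_of_nonneg hyz]
    norm_num
  have h3 : 4 * (y * z) ≤ (1 - x) ^ 2 := by
    rw [show 1 - x = y + z by linarith [h.sum_eq]]
    nlinarith [sq_nonneg (y - z)]
  have hxx : |x| * |1 - x| = x ^ 2 - x := by
    rw [← abs_mul, abs_eq_abs.2 (Or.inr (show x * (1 - x) = -(x ^ 2 - x) by ring)), abs_of_nonneg]
    rcases le_or_gt x 0 with h | h <;> nlinarith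
  have h4 : 4 * (|x| * (y * z)) ≤ (x ^ 2 - x) * |1 - x| := by
    rw [← hxx, mul_assoc, ← sq, sq_abs]
    nlinarith [mul_le_mul_of_nonneg_left h3 (abs_nonneg x)]
  have h5 : 3 * ((x ^ 2 - x) * |1 - x|) ≤ 2 * r * |1 - x| := by
    nlinarith [mul_le_mul_of_nonneg_right hx (abs_nonneg (1 - x))]
  have h6 : r * r ≤ r * (4 * |1 - x| + 3) := by
    rw [show |(-3 : ℤ)| = 3 by norm_num] at h1
    nlinarith
  have h7 : r ≤ 4 * |1 - x| + 3 := le_of_mul_le_mul_left h6 hr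
  have h8 : |1 - x| * |1 - x| - |1 - x| ≤ x ^ 2 - x := by
    rcases abs_cases (1 - x) with ⟨h, _⟩ | ⟨h, _⟩ <;> rw [h] <;> nlinarith
  -- With t = |1 - x| the estimates give 3(t² - t) ≤ 2r ≤ 8t + 6, hence t ≤ 4 and r ≤ 19.
  by_contra hr20
  nlinarith

/-- Among three integers some two have a nonnegative product, and the hypotheses are symmetric under
rotation. -/
theorem lt_twenty (h : IsAdmissible r x y z) (hr : 0 < r)
    (hW : r ≤ |defect r x y z|) (hx : 3 * x ^ 2 - 3 * x ≤ 2 * r)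
    (hy : 3 * y ^ 2 - 3 * y ≤ 2 * r) (hz : 3 * z ^ 2 - 3 * z ≤ 2 * r) : r < 20 := by
  have hrot : defect r y z x = defect r x y z := by unfold defect; ring
  have hrot' : defect r z x y = defect r x y z := by unfold defect; ring
  by_cases h1 : 0 ≤ y * z
  · exact h.lt_twenty_of_mul_nonneg hr hW hx h1
  by_cases h2 : 0 ≤ z * x
  · exact h.rotate.lt_twenty_of_mul_nonneg hr (hrot ▸ hW) hy h2
  refine h.rotate.rotate.lt_twenty_of_mul_nonneg hr (hrot' ▸ hW) hz ?_
  have h3 : 0 < (y * z) * (z * x) := mul_pos_of_neg_of_neg (not_le.1 h1) (not_le.1 h2)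
  by_contra h4
  nlinarith [mul_nonneg (neg_nonneg.2 (not_le.1 h4).le) (sq_nonneg z)]

/-- For y = z the cubic relation factors and forces r + y = 2y(3y - 1). This divides y(4y - 1)(3y -
1), so the odd number 4y - 1 would be even. -/
theorem false_of_eq (h : IsAdmissible r x y z) (hr : 0 < r) (hy : 0 < r + y) (hyz : y = z) :
    False := by
  subst hyz
  obtain rfl : x = 1 - 2 * y := by linarith [h.sum_eq]
  have h0 : (r + y) * (r - (6 * y ^ 2 - 3 * y)) = 0 := by
    linear_combination h.eq_zero
  have hr' : r = 6 * y ^ 2 - 3 * y := by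
    rcases mul_eq_zero.1 h0 with h1 | h1 <;> linarith
  obtain ⟨k, hk⟩ := h.dvd_yz
  have hne : y * (3 * y - 1) ≠ 0 := by
    intro h1
    rcases mul_eq_zero.1 h1 with h2 | h2
    · rw [h2] at hr'; omega
    · omega
  have : 4 * y - 1 = 2 * k := by
    refine mul_left_cancel₀ hne ?_
    linear_combination hk + k * hr'
  omega

/-- The box is exact: 3x² - 3x ≤ 38 means -3 ≤ x ≤ 4. The third variable is eliminated by the sum
relation. -/
theorem small_cases : ∀ r ∈ Finset.Icc (1 : ℤ) 19, ∀ x ∈ Finset.Icc (-3 : ℤ) 4,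
    ∀ y ∈ Finset.Icc (-3 : ℤ) 4, x ≠ y → y ≠ 1 - x - y → 1 - x - y ≠ x →
    r ^ 2 + 2 * r * (x * y + y * (1 - x - y) + (1 - x - y) * x) + 3 * (x * y * (1 - x - y)) = 0 →
    r + x ∣ x * (4 * x - 1) * (3 * y - 1) → r + y ∣ y * (4 * y - 1) * (3 * x - 1) →
    r + (1 - x - y) ∣ (1 - x - y) * (4 * (1 - x - y) - 1) * (3 * x - 1) → False := by
  decide +kernel

/-- Admissible parameters cannot come from real eigenvalues. -/
theorem false (h : IsAdmissible r x y z) (hr : 0 < r) (hx : 0 < r + x) (hy : 0 < r + y)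
    (hz : 0 < r + z) (hbx : 3 * x ^ 2 - 3 * x ≤ 2 * r)
    (hby : 3 * y ^ 2 - 3 * y ≤ 2 * r) (hbz : 3 * z ^ 2 - 3 * z ≤ 2 * r) : False := by
  by_cases hyz : y = z
  · exact h.false_of_eq hr hy hyz
  by_cases hzx : z = x
  · exact h.rotate.false_of_eq hr hz hzx
  by_cases hxy : x = y
  · exact h.rotate.rotate.false_of_eq hr hx hxy
  have hlt := h.lt_twenty hr (h.le_abs_defect hr hx hy hz hxy hyz hzx) hbx hby hbz
  obtain rfl : z = 1 - x - y := by linarith [h.sum_eq]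
  refine small_cases r (Finset.mem_Icc.2 ⟨hr, by omega⟩) x (Finset.mem_Icc.2 ⟨?_, ?_⟩) y
    (Finset.mem_Icc.2 ⟨?_, ?_⟩) hxy hyz hzx h.eq_zero h.dvd_xy h.dvd_yx h.dvd_zx <;> nlinarith

end IsAdmissible
end PrimitiveDegreeThreeP

/-! ### Decomposition of the permutation module -/

namespace PrimitiveDegreeThreeP

open Matrix

set_option linter.unusedSectionVars false

section Decomposition

variable {Ω : Type*} [Fintype Ω] (G : Subgroup (Equiv.Perm Ω))

/-- The permutation representation of `G` on complex valued functions on `Ω`. -/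
noncomputable def permRep : Representation ℂ G (Ω → ℂ) where
  toFun g := LinearMap.funLeft ℂ ℂ fun x => g⁻¹ • x
  map_one' := by ext; simp [LinearMap.funLeft]
  map_mul' g h := by ext; simp [LinearMap.funLeft, mul_smul]

variable {G}

theorem permRep_apply (g : G) (f : Ω → ℂ) (x : Ω) : permRep G g f x = f (g⁻¹ • x) := rfl

theorem character_permRep : (permRep G).character = permChar G := by
  classical
  funext g
  rw [Representation.character, LinearMap.trace_eq_matrix_trace ℂ (Pi.basisFun ℂ Ω), Matrix.trace,
    permChar, Set.ncard_eq_toFinset_card']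
  simp only [Matrix.diag, LinearMap.toMatrix_apply, Pi.basisFun_apply, Pi.basisFun_repr,
    permRep_apply, Pi.single_apply]
  rw [Finset.sum_boole]
  congr 2
  ext x
  simp only [Finset.mem_filter, Finset.mem_univ, true_and, Set.mem_toFinset,
    MulAction.mem_fixedBy]
  rw [inv_smul_eq_iff, eq_comm]

/-- A matrix indexed by `Ω` is `G`-invariant if it commutes with the action of `G`. -/
def IsInvariant (G : Subgroup (Equiv.Perm Ω)) (M : Matrix Ω Ω ℂ) : Prop :=
  ∀ (g : G) (x y : Ω), M (g • x) (g • y) = M x y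

theorem IsInvariant.mulVec_permRep {M : Matrix Ω Ω ℂ} (hM : IsInvariant G M) (g : G) (f : Ω → ℂ) :
    M *ᵥ permRep G g f = permRep G g (M *ᵥ f) := by
  funext x
  simp only [Matrix.mulVec, dotProduct, permRep_apply]
  refine Fintype.sum_equiv (MulAction.toPerm g⁻¹) _ _ fun y => ?_
  rw [← hM g⁻¹ x y]
  rfl

variable {ι : Type*} [Fintype ι] {d : ι → ℕ} {ρ : ∀ i, Representation ℂ G (Fin (d i) → ℂ)}

theorem sum_character_mul_character [Fintype G] (hirr : ∀ i, (ρ i).IsIrreducible)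
    (hinj : Function.Injective fun i => (ρ i).character) [DecidableEq ι] (i j : ι) :
    (Nat.card G : ℂ)⁻¹ * ∑ g : G, (ρ j).character g * (ρ i).character g⁻¹ =
      if i = j then 1 else 0 := by
  classical
  have := hirr i
  have := hirr j
  have : Invertible (Nat.card G : ℂ) := invertibleOfNonzero (by simp)
  rw [Representation.char_orthonormal]
  congr 1
  refine propext ⟨fun ⟨e⟩ => hinj (Representation.char_iso e), ?_⟩
  rintro rfl
  exact ⟨Representation.Equiv.refl _⟩

theorem finrank_intertwiningMap_permRep (hirr : ∀ i, (ρ i).IsIrreducible)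
    (hinj : Function.Injective fun i => (ρ i).character)
    (hsum : permChar G = ∑ i, (ρ i).character) (i : ι) :
    Module.finrank ℂ (Representation.IntertwiningMap (ρ i) (permRep G)) = 1 := by
  classical
  have : Fintype G := Fintype.ofFinite G
  have : Invertible (Nat.card G : ℂ) := invertibleOfNonzero (by simp)
  have h := Representation.card_inv_mul_sum_char_mul_char_eq_finrank (ρ i) (permRep G)
  rw [character_permRep, hsum] at h
  simp only [Finset.sum_apply, Finset.sum_mul] at h
  rw [Finset.sum_comm, Finset.mul_sum] at h
  simp_rw [sum_character_mul_character hirr hinj] at h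
  simp only [Finset.sum_ite_eq, Finset.mem_univ, if_true] at h
  exact_mod_cast h.symm

/-- The operator on the permutation module defined by a character. -/
noncomputable def charOp [Fintype G] {V : Type*} [AddCommGroup V] [Module ℂ V] (χ : G → ℂ)
    (σ : Representation ℂ G V) : V →ₗ[ℂ] V :=
  ∑ g : G, χ g⁻¹ • σ g

theorem charOp_apply_intertwiningMap [Fintype G] {V W : Type*} [AddCommGroup V] [Module ℂ V]
    [AddCommGroup W] [Module ℂ W] (χ : G → ℂ) {σ : Representation ℂ G V}
    {τ : Representation ℂ G W} (f : Representation.IntertwiningMap σ τ) (v : V) :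
    charOp χ τ (f v) = f (charOp χ σ v) := by
  simp only [charOp, LinearMap.sum_apply, LinearMap.smul_apply, map_sum, map_smul,
    f.isIntertwining]

/-- A class function defines an intertwining operator, which is scalar by Schur's lemma; its trace
is |G| times the inner product of the two characters. Such operators separate the constituents
below. -/
theorem charOp_eq_smul [Fintype G] [DecidableEq ι] (hirr : ∀ i, (ρ i).IsIrreducible)
    (hinj : Function.Injective fun i => (ρ i).character) (i j : ι) :
    ∃ c : ℂ, (c = 0 ↔ i ≠ j) ∧ ∀ v, charOp (ρ i).character (ρ j) v = c • v := by
  have := hirr j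
  have hd : d j ≠ 0 := by
    intro h0
    have : Subsingleton (Fin (d j) → ℂ) := by rw [h0]; infer_instance
    have h1 : (⊥ : Subrepresentation (ρ j)) ≠ ⊤ := bot_ne_top
    refine h1 (SetLike.ext fun v => ?_)
    rw [Subsingleton.elim v 0]
    exact iff_of_true (zero_mem (⊥ : Subrepresentation (ρ j)).toSubmodule)
      (zero_mem (⊤ : Subrepresentation (ρ j)).toSubmodule)
  let T : Representation.IntertwiningMap (ρ j) (ρ j) :=
    LinearMap.intertwiningMap_of_isIntertwiningMap (ρ j) (ρ j) (charOp (ρ i).character (ρ j)) (by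
      intro h v
      simp only [charOp, LinearMap.sum_apply, LinearMap.smul_apply, map_sum, map_smul]
      refine Fintype.sum_equiv (MulAut.conj h⁻¹).toEquiv _ _ fun g => ?_
      have h1 : (ρ i).character (h⁻¹ * g * h)⁻¹ = (ρ i).character g⁻¹ := by
        have := Representation.char_conj (ρ i) g⁻¹ h⁻¹
        rwa [show h⁻¹ * g⁻¹ * h⁻¹⁻¹ = (h⁻¹ * g * h)⁻¹ by group] at this
      simp only [MulEquiv.toEquiv_eq_coe, EquivLike.coe_coe, MulAut.conj_apply, inv_inv, h1]
      rw [← Module.End.mul_apply, ← Module.End.mul_apply, ← map_mul, ← map_mul]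
      congr 3
      group)
  have hid : (LinearMap.intertwiningMap_of_isIntertwiningMap (ρ j) (ρ j) LinearMap.id
      (by simp)) ≠ 0 := by
    intro h0
    have h1 : (LinearMap.id : (Fin (d j) → ℂ) →ₗ[ℂ] _) = 0 :=
      congrArg Representation.IntertwiningMap.toLinearMap h0
    have h2 := congrFun (LinearMap.congr_fun h1 fun _ => 1) ⟨0, Nat.pos_of_ne_zero hd⟩
    simp at h2
  obtain ⟨c, hc⟩ := (finrank_eq_one_iff_of_nonzero' _ hid).1
    (Representation.IsIrreducible.finrank_intertwiningMap_self (ρ j)) T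
  have hcv : ∀ v, charOp (ρ i).character (ρ j) v = c • v := fun v =>
    (DFunLike.congr_fun hc v).symm
  refine ⟨c, ?_, hcv⟩
  have htr : LinearMap.trace ℂ _ (charOp (ρ i).character (ρ j)) = c * d j := by
    have : charOp (ρ i).character (ρ j) = c • LinearMap.id := LinearMap.ext hcv
    rw [this, map_smul, LinearMap.trace_id]
    simp
  have h1 := sum_character_mul_character hirr hinj i j
  have h2 : ∑ g : G, (ρ j).character g * (ρ i).character g⁻¹ = c * d j := by
    rw [← htr, charOp, map_sum]
    refine Finset.sum_congr rfl fun g _ => ?_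
    rw [map_smul, smul_eq_mul, mul_comm]
    rfl
  rw [h2] at h1
  have hd' : (d j : ℂ) ≠ 0 := by exact_mod_cast hd
  have hG : (Nat.card G : ℂ) ≠ 0 := by simp
  constructor
  · rintro rfl hij
    simp [hij] at h1
  · intro hij
    rw [if_neg hij] at h1
    simpa [hd', hG] using h1

/-- If the permutation character is a sum of distinct irreducible characters, then all
`G`-invariant matrices are simultaneously diagonalizable, with the multiplicities given by the
degrees. -/
theorem exists_diagonalization [DecidableEq Ω] [DecidableEq ι]
    (hirr : ∀ i, (ρ i).IsIrreducible)
    (hinj : Function.Injective fun i => (ρ i).character)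
    (hsum : permChar G = ∑ i, (ρ i).character) :
    ∃ (f : ∀ i, Representation.IntertwiningMap (ρ i) (permRep G)) (t : Ω → ι)
      (F F' : Matrix Ω Ω ℂ) (ev : ι → Matrix Ω Ω ℂ → ℂ),
      (∀ i, (Finset.univ.filter fun x => t x = i).card = d i) ∧
      (∀ s, ∃ v, ∀ x, F x s = f (t s) v x) ∧ F * F' = 1 ∧ F' * F = 1 ∧
      ∀ M, IsInvariant G M → M * F = F * Matrix.diagonal fun s => ev (t s) M := by
  have : Fintype G := Fintype.ofFinite G
  have hfin := finrank_intertwiningMap_permRep hirr hinj hsum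
  choose f hf0 hf using fun i => finrank_eq_one_iff'.1 (hfin i)
  -- M composed with `f i` is again an intertwining map, and the space of these is spanned by `f i`.
  have hev : ∀ (i : ι) (M : Matrix Ω Ω ℂ), ∃ c : ℂ, IsInvariant G M →
      ∀ v, M *ᵥ f i v = c • f i v := by
    intro i M
    by_cases hM : IsInvariant G M
    · obtain ⟨c, hc⟩ := hf i (LinearMap.intertwiningMap_of_isIntertwiningMap (ρ i) (permRep G)
        (M.mulVecLin ∘ₗ (f i).toLinearMap) (by
          intro g v
          simp [(f i).isIntertwining, hM.mulVec_permRep]))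
      exact ⟨c, fun _ v => (DFunLike.congr_fun hc v).symm⟩
    · exact ⟨0, fun h => absurd h hM⟩
  choose ev hev using hev
  have hfinj : ∀ i, Function.Injective (f i) := fun i =>
    have := hirr i
    (Representation.IsIrreducible.injective_or_eq_zero (f i)).resolve_right (hf0 i)
  have hcard : Fintype.card Ω = Fintype.card (Σ i, Fin (d i)) := by
    have h1 := congrFun hsum 1
    rw [← character_permRep, Finset.sum_apply] at h1
    simp only [Representation.char_one, Module.finrank_fintype_fun_eq_card, Fintype.card_fin] at h1
    simp only [Fintype.card_sigma, Fintype.card_fin]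
    exact_mod_cast h1
  let e : Ω ≃ Σ i, Fin (d i) := Fintype.equivOfCardEq hcard
  let L : (Ω → ℂ) →ₗ[ℂ] (Ω → ℂ) :=
    ∑ i, (f i).toLinearMap ∘ₗ LinearMap.funLeft ℂ ℂ fun k => e.symm ⟨i, k⟩
  have hL : ∀ v, L v = ∑ i, f i fun k => v (e.symm ⟨i, k⟩) := by
    intro v
    simp only [L, LinearMap.sum_apply]
    rfl
  -- The operator of the i-th character annihilates every component except the i-th and rescales
  -- that one by a nonzero factor.
  have hLinj : Function.Injective L := by
    rw [← LinearMap.ker_eq_bot, LinearMap.ker_eq_bot']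
    intro v hv
    funext x
    obtain ⟨⟨i, k⟩, rfl⟩ := e.symm.surjective x
    have h1 : charOp (ρ i).character (permRep G) (L v) = 0 := by rw [hv, map_zero]
    rw [hL, map_sum] at h1
    simp_rw [charOp_apply_intertwiningMap] at h1
    choose c hc0 hc using charOp_eq_smul hirr hinj i
    simp_rw [hc, map_smul] at h1
    rw [Finset.sum_eq_single i (fun j _ hj => by rw [(hc0 j).2 hj.symm, zero_smul])
      (fun h => absurd (Finset.mem_univ i) h)] at h1
    have h2 := (smul_eq_zero.1 h1).resolve_left (fun h => (hc0 i).1 h rfl)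
    have h3 := hfinj i (h2.trans (map_zero (f i)).symm)
    exact congrFun h3 k
  let E := LinearEquiv.ofInjectiveEndo L hLinj
  have hEL : (E : (Ω → ℂ) →ₗ[ℂ] (Ω → ℂ)) = L := LinearMap.ext fun v => rfl
  refine ⟨f, fun x => (e x).1, LinearMap.toMatrix' L, LinearMap.toMatrix' (E.symm : (Ω → ℂ) →ₗ[ℂ] _),
    ev, ?_, ?_, ?_, ?_, ?_⟩
  · intro i
    rw [← Fintype.card_fin (d i), ← Finset.card_univ]
    refine (Finset.card_bij (fun k _ => e.symm ⟨i, k⟩) ?_ ?_ ?_).symm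
    · intro k _
      simp
    · intro k _ k' _ h
      simpa using h
    · intro x hx
      obtain ⟨⟨j, k⟩, rfl⟩ := e.symm.surjective x
      obtain rfl : j = i := by simpa using hx
      exact ⟨k, Finset.mem_univ _, rfl⟩
  · intro s
    refine ⟨fun k => (Pi.single s 1 : Ω → ℂ) (e.symm ⟨(e s).1, k⟩), fun x => ?_⟩
    rw [LinearMap.toMatrix'_apply, hL, Finset.sum_eq_single (e s).1]
    · intro i _ hi
      have : (fun k => (Pi.single s 1 : Ω → ℂ) (e.symm ⟨i, k⟩)) = 0 := by
        funext k
        rw [Pi.single_apply, if_neg]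
        · rfl
        · rintro rfl
          exact hi (by simp)
      rw [this, map_zero]
    · simp
  · rw [← hEL, ← LinearMap.toMatrix'_comp]
    simp
  · rw [← hEL, ← LinearMap.toMatrix'_comp]
    simp
  · intro M hM
    have : Matrix.toLin' M ∘ₗ L = L ∘ₗ Matrix.toLin' (Matrix.diagonal fun s => ev (e s).1 M) := by
      refine LinearMap.ext fun v => ?_
      simp only [LinearMap.comp_apply, Matrix.toLin'_apply, hL, Matrix.mulVec_sum]
      refine Finset.sum_congr rfl fun i _ => ?_
      rw [hev i M hM, ← map_smul]
      congr 1
      funext k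
      rw [Matrix.mulVec_diagonal]
      simp
    simpa only [LinearMap.toMatrix'_comp, LinearMap.toMatrix'_toLin'] using
      congrArg LinearMap.toMatrix' this

end Decomposition
end PrimitiveDegreeThreeP

/-! ### Simultaneous diagonalization and rank four -/

namespace PrimitiveDegreeThreeP

open Matrix

set_option linter.unusedSectionVars false

variable {Ω : Type*} [Fintype Ω] {G : Subgroup (Equiv.Perm Ω)}

theorem isIrreducibleCharacter_one {X : Type*} [Group X] :
    IsIrreducibleCharacter (1 : X → ℂ) := by
  refine ⟨1, Representation.trivial ℂ X (Fin 1 → ℂ), ?_, ?_⟩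
  · have hs : IsSimpleOrder (Submodule ℂ (Fin 1 → ℂ)) := by
      have : IsSimpleModule ℂ (Fin 1 → ℂ) := isSimpleModule_iff_finrank_eq_one.2 (by simp)
      exact (isSimpleModule_iff _ _).1 this
    exact
      { exists_pair_ne := by
          refine ⟨⊥, ⊤, fun h => ?_⟩
          have : (⊥ : Submodule ℂ (Fin 1 → ℂ)) = ⊤ :=
            congrArg Subrepresentation.toSubmodule h
          exact bot_ne_top this
        eq_bot_or_eq_top := by
          intro S
          rcases hs.eq_bot_or_eq_top S.toSubmodule with h | h
          · exact Or.inl (SetLike.ext fun v => by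
              change v ∈ S.toSubmodule ↔ v ∈ (⊥ : Submodule ℂ (Fin 1 → ℂ))
              rw [h])
          · exact Or.inr (SetLike.ext fun v => by
              change v ∈ S.toSubmodule ↔ v ∈ (⊤ : Submodule ℂ (Fin 1 → ℂ))
              rw [h]) }
  · funext g
    simp [Representation.character, Representation.trivial]

/-- A simultaneous diagonalization of the `G`-invariant matrices, with multiplicities
`1`, `p`, `p`, `p - 1`, the first eigenspace consisting of the constant functions. -/
structure Spectrum [DecidableEq Ω] (G : Subgroup (Equiv.Perm Ω)) (p : ℕ) where
  /-- The block to which a basis vector belongs. -/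
  block : Ω → Fin 4
  /-- The matrix of eigenvectors. -/
  vec : Matrix Ω Ω ℂ
  /-- The inverse of the matrix of eigenvectors. -/
  vecInv : Matrix Ω Ω ℂ
  /-- The eigenvalues of a matrix. -/
  ev : Fin 4 → Matrix Ω Ω ℂ → ℂ
  card_block : ∀ i, (Finset.univ.filter fun x => block x = i).card = ![1, p, p, p - 1] i
  vec_mul_vecInv : vec * vecInv = 1
  vecInv_mul_vec : vecInv * vec = 1
  mul_vec : ∀ M, IsInvariant G M → M * vec = vec * Matrix.diagonal fun s => ev (block s) M
  vec_eq : ∀ s, block s = 0 → ∀ x y, vec x s = vec y s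

theorem IsTypeIV.exists_irreducible {p : ℕ} (h : IsTypeIV G p) (hp : 1 ≤ p) :
    ∃ ρ : ∀ i : Fin 4, Representation ℂ G (Fin (![1, p, p, p - 1] i) → ℂ),
      (∀ i, (ρ i).IsIrreducible) ∧ Function.Injective (fun i => (ρ i).character) ∧
      permChar G = ∑ i, (ρ i).character ∧ (ρ 0).character = 1 := by
  obtain ⟨χ₁, χ₂, χ₃, h1, h2, h3, n1, n2, n3, n12, n13, n23, d1, d2, d3, hsum⟩ := h
  have key : ∀ (χ : G → ℂ) (n : ℕ), IsIrreducibleCharacter χ → χ 1 = n →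
      ∃ ρ : Representation ℂ G (Fin n → ℂ), ρ.IsIrreducible ∧ χ = ρ.character := by
    rintro χ n ⟨m, ρ, hρ, rfl⟩ hn
    rw [Representation.char_one] at hn
    obtain rfl : m = n := by simpa using hn
    exact ⟨ρ, hρ, rfl⟩
  have hd : ∀ i, ∃ ρ : Representation ℂ G (Fin (![1, p, p, p - 1] i) → ℂ),
      ρ.IsIrreducible ∧ (![1, χ₁, χ₂, χ₃] i : G → ℂ) = ρ.character := by
    intro i
    fin_cases i
    · exact key _ _ isIrreducibleCharacter_one (by simp)
    · exact key _ _ h1 d1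
    · exact key _ _ h2 d2
    · exact key _ _ h3 (by
        change χ₃ 1 = ((p - 1 : ℕ) : ℂ)
        rw [d3, Nat.cast_sub hp, Nat.cast_one])
  choose ρ hirr hχ using hd
  refine ⟨ρ, hirr, ?_, ?_, (hχ 0).symm⟩
  · simp_rw [← hχ]
    intro i j hij
    fin_cases i <;> fin_cases j <;> first | rfl | (simp at hij; simp_all [eq_comm])
  · simp_rw [← hχ]
    rw [hsum, Fin.sum_univ_four]
    rfl

theorem IsTypeIV.nonempty_spectrum [DecidableEq Ω] {p : ℕ} (h : IsTypeIV G p) (hp : 1 ≤ p)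
    [MulAction.IsPretransitive G Ω] : Nonempty (Spectrum G p) := by
  obtain ⟨ρ, hirr, hinj, hsum, h0⟩ := h.exists_irreducible hp
  have : Fintype G := Fintype.ofFinite G
  obtain ⟨f, t, F, F', ev, hcard, hF, hFF', hF'F, hev⟩ := exists_diagonalization hirr hinj hsum
  refine ⟨⟨t, F, F', ev, hcard, hFF', hF'F, hev, ?_⟩⟩
  intro s hs x y
  have hF0 : ∀ i, t s = i → ∃ v, ∀ x, F x s = f i v x := by
    rintro i rfl
    exact hF s
  obtain ⟨v, hv⟩ := hF0 0 hs
  obtain ⟨c, hc0, hc⟩ := charOp_eq_smul hirr hinj 0 0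
  have hc0' : c ≠ 0 := fun h => hc0.1 h rfl
  -- For the trivial character `charOp` is the sum over the group. It acts as a nonzero scalar, so
  -- every vector is a multiple of a group sum and is therefore fixed.
  have hinv : ∀ g : G, ρ 0 g v = v := by
    intro g
    have hcv : v = c⁻¹ • charOp (ρ 0).character (ρ 0) v := by
      rw [hc, smul_smul, inv_mul_cancel₀ hc0', one_smul]
    have h1 : ρ 0 g (charOp (ρ 0).character (ρ 0) v) = charOp (ρ 0).character (ρ 0) v := by
      simp only [charOp, h0, Pi.one_apply, one_smul, LinearMap.sum_apply, map_sum]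
      refine Fintype.sum_equiv (Equiv.mulLeft g) _ _ fun k => ?_
      rw [Equiv.coe_mulLeft, map_mul]
      rfl
    rw [hcv, map_smul, h1]
  obtain ⟨g, rfl⟩ := MulAction.exists_smul_eq G y x
  rw [hv, hv]
  have h2 := congrFun (Representation.IntertwiningMap.isIntertwining _ _ (f 0) g v) (g • y)
  rw [hinv, permRep_apply, inv_smul_smul] at h2
  exact h2

/-- Burnside's count on Ω × Ω, where g fixes π(g)² pairs: the rank is the norm of π, one for each of
its four distinct constituents. -/
theorem IsTypeIV.card_orbits {p : ℕ} (h : IsTypeIV G p) (hp : 1 ≤ p) :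
    Nat.card (MulAction.orbitRel.Quotient G (Ω × Ω)) = 4 := by
  classical
  obtain ⟨ρ, hirr, hinj, hsum, -⟩ := h.exists_irreducible hp
  have : Fintype G := Fintype.ofFinite G
  have h1 : (Nat.card G : ℂ)⁻¹ * ∑ g : G, permChar G g * permChar G g⁻¹ = 4 := by
    simp only [hsum, Finset.sum_apply, Finset.sum_mul_sum]
    rw [Finset.sum_comm, Finset.mul_sum]
    have h2 : ∀ i, (Nat.card G : ℂ)⁻¹ * ∑ g : G, ∑ j, (ρ i).character g * (ρ j).character g⁻¹ =
        1 := by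
      intro i
      rw [Finset.sum_comm, Finset.mul_sum]
      simp_rw [sum_character_mul_character hirr hinj]
      simp
    simp_rw [h2]
    simp
  have h2 := MulAction.sum_card_fixedBy_eq_card_orbits_mul_card_group G (Ω × Ω)
  have h3 : ∀ g : G, permChar G g * permChar G g⁻¹ =
      (Fintype.card (MulAction.fixedBy (Ω × Ω) g) : ℂ) := by
    intro g
    have h4 : MulAction.fixedBy (Ω × Ω) g = MulAction.fixedBy Ω g ×ˢ MulAction.fixedBy Ω g := by
      ext ⟨x, y⟩
      simp [MulAction.mem_fixedBy, Prod.ext_iff]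
    rw [permChar, permChar, MulAction.fixedBy_inv, ← Nat.card_eq_fintype_card, Nat.card_coe_set_eq,
      h4, Set.ncard_prod, Nat.cast_mul]
  simp_rw [h3] at h1
  rw [← Nat.cast_sum, h2] at h1
  have hG : (Nat.card G : ℂ) ≠ 0 := by simp
  rw [← Nat.card_eq_fintype_card (α := G)] at h1
  push_cast at h1
  rw [mul_comm (_ : ℂ) (Nat.card G : ℂ), inv_mul_cancel_left₀ hG] at h1
  rw [Nat.card_eq_fintype_card]
  exact_mod_cast h1

end PrimitiveDegreeThreeP

/-! ### Eigenvalues of invariant matrices -/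

namespace PrimitiveDegreeThreeP

open Matrix

set_option linter.unusedSectionVars false

variable {Ω : Type*} [Fintype Ω] [DecidableEq Ω] {G : Subgroup (Equiv.Perm Ω)} {p : ℕ}

namespace IsInvariant

variable {M N : Matrix Ω Ω ℂ}

theorem mul (hM : IsInvariant G M) (hN : IsInvariant G N) : IsInvariant G (M * N) := by
  intro g x y
  rw [Matrix.mul_apply, Matrix.mul_apply]
  refine (Fintype.sum_equiv (MulAction.toPerm g) _ _ fun z => ?_).symm
  rw [MulAction.toPerm_apply, hM, hN]

theorem conjTranspose (hM : IsInvariant G M) : IsInvariant G Mᴴ := fun g x y => by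
  rw [conjTranspose_apply, conjTranspose_apply, hM]

theorem sum {ι : Type*} {s : Finset ι} {M : ι → Matrix Ω Ω ℂ} (h : ∀ i, IsInvariant G (M i)) :
    IsInvariant G (∑ i ∈ s, M i) := fun g x y => by
  rw [Matrix.sum_apply, Matrix.sum_apply]
  exact Finset.sum_congr rfl fun i _ => h i g x y

end IsInvariant

namespace Spectrum

variable (S : Spectrum G p) {M N : Matrix Ω Ω ℂ}

theorem exists_block (hp : 2 ≤ p) (i : Fin 4) : ∃ s, S.block s = i := by
  have h : 0 < (Finset.univ.filter fun x => S.block x = i).card := by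
    rw [S.card_block]
    fin_cases i <;> simp <;> omega
  obtain ⟨s, hs⟩ := Finset.card_pos.1 h
  exact ⟨s, (Finset.mem_filter.1 hs).2⟩

theorem eq_of_vec_mul_eq {M N : Matrix Ω Ω ℂ} (h : S.vec * M = S.vec * N) : M = N := by
  have := congrArg (S.vecInv * ·) h
  simpa only [← Matrix.mul_assoc, S.vecInv_mul_vec, Matrix.one_mul] using this

theorem ev_eq_of (hp : 2 ≤ p) (hM : IsInvariant G M) {μ : Fin 4 → ℂ}
    (h : M * S.vec = S.vec * Matrix.diagonal fun s => μ (S.block s)) (i : Fin 4) :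
    S.ev i M = μ i := by
  rw [S.mul_vec M hM] at h
  obtain ⟨s, rfl⟩ := S.exists_block hp i
  exact congrFun (Matrix.diagonal_injective (S.eq_of_vec_mul_eq h)) s

theorem ev_mul (hp : 2 ≤ p) (hM : IsInvariant G M) (hN : IsInvariant G N) (i : Fin 4) :
    S.ev i (M * N) = S.ev i M * S.ev i N := by
  refine S.ev_eq_of hp (hM.mul hN) (μ := fun i => S.ev i M * S.ev i N) ?_ i
  rw [Matrix.mul_assoc, S.mul_vec N hN, ← Matrix.mul_assoc, S.mul_vec M hM, Matrix.mul_assoc,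
    Matrix.diagonal_mul_diagonal]

theorem ev_sum (hp : 2 ≤ p) {ι : Type*} {s : Finset ι} {M : ι → Matrix Ω Ω ℂ}
    (h : ∀ i, IsInvariant G (M i)) (j : Fin 4) :
    S.ev j (∑ i ∈ s, M i) = ∑ i ∈ s, S.ev j (M i) := by
  refine S.ev_eq_of hp (IsInvariant.sum h) (μ := fun j => ∑ i ∈ s, S.ev j (M i)) ?_ j
  rw [Matrix.sum_mul]
  simp_rw [S.mul_vec _ (h _)]
  rw [← Matrix.mul_sum]
  congr 1
  ext x y
  rw [Matrix.sum_apply]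
  by_cases hxy : x = y
  · subst hxy
    simp
  · simp [hxy]

theorem ev_smul_one (hp : 2 ≤ p) (c : ℂ) (hM : IsInvariant G (c • (1 : Matrix Ω Ω ℂ)))
    (j : Fin 4) : S.ev j (c • (1 : Matrix Ω Ω ℂ)) = c := by
  refine S.ev_eq_of hp hM (μ := fun _ => c) ?_ j
  rw [← Matrix.smul_one_eq_diagonal]
  simp

theorem eq_mul_diagonal_mul (hM : IsInvariant G M) :
    M = S.vec * (Matrix.diagonal fun s => S.ev (S.block s) M) * S.vecInv := by
  rw [← S.mul_vec M hM, Matrix.mul_assoc, S.vec_mul_vecInv, Matrix.mul_one]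

theorem sum_block (hp : 1 ≤ p) (μ : Fin 4 → ℂ) :
    ∑ s, μ (S.block s) = μ 0 + p * μ 1 + p * μ 2 + (p - 1) * μ 3 := by
  rw [← Finset.sum_fiberwise_of_maps_to (t := Finset.univ) (g := S.block) (fun _ _ => Finset.mem_univ _)]
  have : ∀ i : Fin 4, ∑ s ∈ Finset.univ.filter (fun s => S.block s = i), μ (S.block s) =
      (![1, p, p, p - 1] i : ℕ) * μ i := by
    intro i
    rw [← S.card_block i, ← nsmul_eq_mul, ← Finset.sum_const]
    exact Finset.sum_congr rfl fun s hs => by rw [(Finset.mem_filter.1 hs).2]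
  simp_rw [this, Fin.sum_univ_four]
  simp [Nat.cast_sub hp]

theorem trace_eq (hp : 1 ≤ p) (hM : IsInvariant G M) :
    M.trace = S.ev 0 M + p * S.ev 1 M + p * S.ev 2 M + (p - 1) * S.ev 3 M := by
  rw [← S.sum_block hp fun i => S.ev i M]
  conv_lhs => rw [S.eq_mul_diagonal_mul hM, Matrix.trace_mul_comm, ← Matrix.mul_assoc,
    S.vecInv_mul_vec, Matrix.one_mul]
  exact Matrix.trace_diagonal _

theorem charpoly_eq (hM : IsInvariant G M) :
    M.charpoly = ∏ s, (Polynomial.X - Polynomial.C (S.ev (S.block s) M)) := by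
  conv_lhs => rw [S.eq_mul_diagonal_mul hM, Matrix.charpoly_mul_comm, ← Matrix.mul_assoc,
    S.vecInv_mul_vec, Matrix.one_mul]
  exact Matrix.charpoly_diagonal _

theorem col_ne_zero (s : Ω) : (fun x => S.vec x s) ≠ 0 := by
  intro h
  have h1 := congrFun (congrFun S.vecInv_mul_vec s) s
  rw [Matrix.mul_apply, Matrix.one_apply_eq] at h1
  simp [fun x => congrFun h x] at h1

theorem mulVec_col (hM : IsInvariant G M) (s : Ω) :
    M *ᵥ (fun x => S.vec x s) = S.ev (S.block s) M • fun x => S.vec x s := by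
  funext x
  have h := congrFun (congrFun (S.mul_vec M hM) x) s
  rw [Matrix.mul_diagonal, Matrix.mul_apply] at h
  simpa [Matrix.mulVec, dotProduct, mul_comm] using h

open scoped ComplexOrder in
-- M and its adjoint share the eigenvector u; compare the inner products ⟨u, Mᴴu⟩ = ⟨Mu, u⟩ and
-- cancel ⟨u, u⟩.
theorem ev_conjTranspose (hp : 2 ≤ p) (hM : IsInvariant G M) (i : Fin 4) :
    S.ev i Mᴴ = star (S.ev i M) := by
  obtain ⟨s, rfl⟩ := S.exists_block hp i
  set u := fun x => S.vec x s with hu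
  have hu0 : star u ⬝ᵥ u ≠ 0 := fun h => S.col_ne_zero s (dotProduct_star_self_eq_zero.1 h)
  have h1 : star u ⬝ᵥ (Mᴴ *ᵥ u) = star (M *ᵥ u) ⬝ᵥ u := by
    rw [Matrix.star_mulVec, Matrix.dotProduct_mulVec]
  rw [S.mulVec_col hM, S.mulVec_col hM.conjTranspose, dotProduct_smul, star_smul, smul_dotProduct]
    at h1
  exact mul_right_cancel₀ hu0 h1

theorem ev_zero (hp : 2 ≤ p) (hM : IsInvariant G M) {n : ℂ} (h : ∀ x, ∑ y, M x y = n) :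
    S.ev 0 M = n := by
  obtain ⟨s, hs⟩ := S.exists_block hp 0
  obtain ⟨x, hx⟩ := Function.ne_iff.1 (S.col_ne_zero s)
  have h1 := congrFun (S.mulVec_col hM s) x
  simp only [hs, Matrix.mulVec, dotProduct, Pi.smul_apply, smul_eq_mul] at h1
  have h2 : ∀ y, M x y * S.vec y s = M x y * S.vec x s := fun y => by rw [S.vec_eq s hs y x]
  simp_rw [h2] at h1
  rw [← Finset.sum_mul, h] at h1
  exact (mul_right_cancel₀ hx h1).symm

theorem rootMultiplicity_charpoly (hM : IsInvariant G M) (z : ℂ) :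
    M.charpoly.rootMultiplicity z =
      (Finset.univ.filter fun s => S.ev (S.block s) M = z).card := by
  classical
  rw [S.charpoly_eq hM, ← Polynomial.count_roots, Polynomial.roots_prod _ _
    (Finset.prod_ne_zero_iff.2 fun s _ => Polynomial.X_sub_C_ne_zero _)]
  simp only [Polynomial.roots_X_sub_C, Multiset.bind_singleton]
  rw [Multiset.count_map, Finset.card_def, Finset.filter_val]
  simp_rw [eq_comm]

theorem card_filter_ev (z : ℂ) :
    (Finset.univ.filter fun s => S.ev (S.block s) M = z).card =
      ∑ i, if S.ev i M = z then ![1, p, p, p - 1] i else 0 := by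
  rw [Finset.card_eq_sum_card_fiberwise (f := S.block) (t := Finset.univ)
    (fun _ _ => Finset.mem_univ _)]
  refine Finset.sum_congr rfl fun i _ => ?_
  split_ifs with h
  · rw [← S.card_block i, Finset.filter_filter]
    congr 1
    ext s
    simp only [Finset.mem_filter, Finset.mem_univ, true_and]
    exact ⟨fun h => h.2, fun hs => ⟨by rwa [hs], hs⟩⟩
  · rw [Finset.card_eq_zero, Finset.filter_filter, Finset.filter_eq_empty_iff]
    rintro s - ⟨h1, h2⟩
    exact h (h2 ▸ h1)

end Spectrum

open Polynomial in
theorem isRoot_iff_of_minpoly_eq {z w : ℂ} (h : minpoly ℚ z = minpoly ℚ w) (P : ℚ[X]) :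
    (P.map (algebraMap ℚ ℂ)).IsRoot z ↔ (P.map (algebraMap ℚ ℂ)).IsRoot w := by
  rw [IsRoot, IsRoot, eval_map_algebraMap, eval_map_algebraMap, ← minpoly.dvd_iff,
    ← minpoly.dvd_iff, h]

open Polynomial in
-- Multiplicity is detected by the vanishing of iterated derivatives, which are again rational
-- polynomials and so vanish at both numbers or at neither.
theorem rootMultiplicity_eq_of_minpoly_eq {z w : ℂ} (h : minpoly ℚ z = minpoly ℚ w) {P : ℚ[X]}
    (hP : P ≠ 0) : (P.map (algebraMap ℚ ℂ)).rootMultiplicity z =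
      (P.map (algebraMap ℚ ℂ)).rootMultiplicity w := by
  have hP' : P.map (algebraMap ℚ ℂ) ≠ 0 := (Polynomial.map_ne_zero_iff (algebraMap ℚ ℂ).injective).2 hP
  refine eq_of_forall_lt_iff fun n => ?_
  rw [lt_rootMultiplicity_iff_isRoot_iterate_derivative hP',
    lt_rootMultiplicity_iff_isRoot_iterate_derivative hP']
  simp_rw [iterate_derivative_map, isRoot_iff_of_minpoly_eq h]

end PrimitiveDegreeThreeP

/-! ### Orbitals and their adjacency matrices -/

namespace PrimitiveDegreeThreeP

open Matrix

set_option linter.unusedSectionVars false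

/-- A labelling of the orbits of `G` on `Ω × Ω` by `Fin 4`, the diagonal having label `0`. -/
structure Coloring {Ω : Type*} (G : Subgroup (Equiv.Perm Ω)) where
  /-- The label of the orbit of a pair. -/
  color : Ω → Ω → Fin 4
  color_eq_iff : ∀ x y x' y', color x y = color x' y' ↔ ∃ g : G, g • x = x' ∧ g • y = y'
  color_self : ∀ x, color x x = 0
  exists_color : ∀ i, ∃ x y, color x y = i

variable {Ω : Type*} {G : Subgroup (Equiv.Perm Ω)}

theorem nonempty_coloring [Nonempty Ω] [MulAction.IsPretransitive G Ω]
    (h : Nat.card (MulAction.orbitRel.Quotient G (Ω × Ω)) = 4) : Nonempty (Coloring G) := by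
  have : Finite (MulAction.orbitRel.Quotient G (Ω × Ω)) := Nat.finite_of_card_ne_zero (by omega)
  let e₀ : MulAction.orbitRel.Quotient G (Ω × Ω) ≃ Fin 4 := Finite.equivFinOfCardEq h
  obtain ⟨a⟩ := ‹Nonempty Ω›
  let q : Ω → Ω → MulAction.orbitRel.Quotient G (Ω × Ω) := fun x y => Quotient.mk'' (x, y)
  -- The transposition moves the diagonal to label 0.
  let e := e₀.trans (Equiv.swap (e₀ (q a a)) 0)
  have hq : ∀ x y x' y', q x y = q x' y' ↔ ∃ g : G, g • x = x' ∧ g • y = y' := by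
    intro x y x' y'
    rw [eq_comm, Quotient.eq'', MulAction.orbitRel_apply, MulAction.mem_orbit_iff]
    simp [Prod.ext_iff]
  refine ⟨⟨fun x y => e (q x y), ?_, ?_, ?_⟩⟩
  · intro x y x' y'
    rw [e.injective.eq_iff, hq]
  · intro x
    obtain ⟨g, rfl⟩ := MulAction.exists_smul_eq G a x
    rw [← (hq a a (g • a) (g • a)).2 ⟨g, rfl, rfl⟩]
    simp [e]
  · intro i
    obtain ⟨z, hz⟩ := e.surjective i
    obtain ⟨⟨x, y⟩, rfl⟩ := Quotient.mk''_surjective z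
    exact ⟨x, y, hz⟩

namespace Coloring

variable (C : Coloring G)

theorem color_smul (g : G) (x y : Ω) : C.color (g • x) (g • y) = C.color x y :=
  ((C.color_eq_iff _ _ _ _).2 ⟨g, rfl, rfl⟩).symm

theorem color_eq_zero_iff {x y : Ω} : C.color x y = 0 ↔ x = y := by
  constructor
  · intro h
    rw [← C.color_self x, eq_comm, C.color_eq_iff] at h
    obtain ⟨g, h1, h2⟩ := h
    exact h1.symm.trans h2
  · rintro rfl
    exact C.color_self x

/-- The label of the reversed orbit. -/
noncomputable def inv (i : Fin 4) : Fin 4 :=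
  C.color (C.exists_color i).choose_spec.choose (C.exists_color i).choose

theorem color_swap (x y : Ω) : C.color y x = C.inv (C.color x y) := by
  have h := (C.exists_color (C.color x y)).choose_spec.choose_spec
  rw [C.color_eq_iff] at h
  obtain ⟨g, h1, h2⟩ := h
  rw [inv, eq_comm, C.color_eq_iff]
  exact ⟨g, h2, h1⟩

theorem color_swap_eq_iff {x y : Ω} {i : Fin 4} : C.color y x = C.inv i ↔ C.color x y = i := by
  constructor
  · intro h
    obtain ⟨x', y', rfl⟩ := C.exists_color i
    rw [← C.color_swap, C.color_eq_iff] at h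
    obtain ⟨g, h1, h2⟩ := h
    exact (C.color_eq_iff _ _ _ _).2 ⟨g, h2, h1⟩
  · rintro rfl
    exact C.color_swap x y

theorem inv_inv (i : Fin 4) : C.inv (C.inv i) = i := by
  obtain ⟨x, y, rfl⟩ := C.exists_color i
  rw [← C.color_swap, ← C.color_swap]

theorem inv_zero : C.inv 0 = 0 := by
  obtain ⟨x, y, h⟩ := C.exists_color 0
  have := C.color_swap x y
  rw [h] at this
  rw [← this, C.color_eq_zero_iff, ← C.color_eq_zero_iff.1 h]

section Adjacency

variable [Fintype Ω] [DecidableEq Ω]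

/-- The number of points in relation `i` with `x`. -/
def degAt (x : Ω) (i : Fin 4) : ℕ := (Finset.univ.filter fun y => C.color x y = i).card

theorem degAt_eq [MulAction.IsPretransitive G Ω] (x x' : Ω) (i : Fin 4) :
    C.degAt x i = C.degAt x' i := by
  obtain ⟨g, rfl⟩ := MulAction.exists_smul_eq G x x'
  refine Finset.card_equiv (MulAction.toPerm g) fun y => ?_
  simp [C.color_smul]

theorem sum_degAt (x : Ω) : ∑ i, C.degAt x i = Fintype.card Ω := by
  rw [← Finset.card_univ, Finset.card_eq_sum_card_fiberwise (f := C.color x) (t := Finset.univ)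
    (fun _ _ => Finset.mem_univ _)]
  rfl

theorem degAt_zero (x : Ω) : C.degAt x 0 = 1 := by
  rw [degAt, Finset.card_eq_one]
  refine ⟨x, ?_⟩
  ext y
  simp [C.color_eq_zero_iff, eq_comm]

theorem degAt_pos [MulAction.IsPretransitive G Ω] (x : Ω) (i : Fin 4) : 0 < C.degAt x i := by
  obtain ⟨x', y, h⟩ := C.exists_color i
  rw [C.degAt_eq x x', degAt, Finset.card_pos]
  exact ⟨y, by simpa using h⟩

theorem card_mul_degAt [MulAction.IsPretransitive G Ω] (x : Ω) (i : Fin 4) :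
    ∑ y, ∑ z, (if C.color y z = i then (1 : ℕ) else 0) = Fintype.card Ω * C.degAt x i := by
  simp_rw [Finset.sum_boole]
  have : ∀ y, (Finset.univ.filter fun z => C.color y z = i).card = C.degAt x i :=
    fun y => C.degAt_eq y x i
  simp [this]

theorem degAt_inv [MulAction.IsPretransitive G Ω] (x : Ω) (i : Fin 4) :
    C.degAt x (C.inv i) = C.degAt x i := by
  have h1 := C.card_mul_degAt x i
  rw [Finset.sum_comm] at h1
  have h2 : ∀ y z, (if C.color z y = i then (1 : ℕ) else 0) =
      if C.color y z = C.inv i then 1 else 0 := fun y z => by simp only [C.color_swap_eq_iff]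
  simp_rw [h2] at h1
  rw [C.card_mul_degAt x] at h1
  have : 0 < Fintype.card Ω := Fintype.card_pos_iff.2 ⟨x⟩
  exact Nat.eq_of_mul_eq_mul_left this h1

/-- The adjacency matrix of the relation with label `i`. -/
def adj (i : Fin 4) : Matrix Ω Ω ℂ := Matrix.of fun x y => if C.color x y = i then 1 else 0

theorem adj_apply (i : Fin 4) (x y : Ω) : C.adj i x y = if C.color x y = i then 1 else 0 := rfl

theorem isInvariant_adj (i : Fin 4) : IsInvariant G (C.adj i) := fun g x y => by
  rw [adj_apply, adj_apply, C.color_smul]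

theorem conjTranspose_adj (i : Fin 4) : (C.adj i)ᴴ = C.adj (C.inv i) := by
  ext x y
  rw [conjTranspose_apply, adj_apply, adj_apply]
  simp_rw [C.color_swap_eq_iff]
  split_ifs <;> simp

theorem adj_zero : C.adj 0 = 1 := by
  ext x y
  rw [adj_apply, Matrix.one_apply]
  simp_rw [C.color_eq_zero_iff]

theorem sum_adj_apply (i : Fin 4) (x : Ω) : ∑ y, C.adj i x y = C.degAt x i := by
  simp_rw [adj_apply, Finset.sum_boole]
  rfl

theorem sum_adj : ∑ i, C.adj i = Matrix.of fun _ _ => 1 := by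
  ext x y
  rw [Matrix.sum_apply]
  simp [adj_apply]

theorem adj_eq_map (i : Fin 4) :
    ∃ A : Matrix Ω Ω ℤ, C.adj i = A.map (Int.castRingHom ℂ) :=
  ⟨Matrix.of fun x y => if C.color x y = i then 1 else 0, by
    ext x y
    simp [adj_apply]⟩

theorem trace_adj {i : Fin 4} (hi : i ≠ 0) : (C.adj i).trace = 0 := by
  simp [Matrix.trace, adj_apply, C.color_self, hi.symm]

theorem trace_adj_mul_adj [MulAction.IsPretransitive G Ω] (x : Ω) (i j : Fin 4) :
    (C.adj i * C.adj j).trace =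
      if j = C.inv i then (Fintype.card Ω : ℂ) * C.degAt x i else 0 := by
  have h1 : (C.adj i * C.adj j).trace =
      ∑ y, ∑ z, if C.color y z = i then (if j = C.inv i then (1 : ℂ) else 0) else 0 := by
    simp only [Matrix.trace, Matrix.diag, Matrix.mul_apply, adj_apply]
    refine Finset.sum_congr rfl fun y _ => Finset.sum_congr rfl fun z _ => ?_
    by_cases h : C.color y z = i
    · rw [C.color_swap y z, h]
      simp [eq_comm]
    · simp [h]
  rw [h1]
  split_ifs with h
  · have := C.card_mul_degAt x i
    exact_mod_cast this
  · simp

/-- The trace counts closed triangles: m is an intersection number, the same for every base pair of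
label k. This integer is the source of all later divisibilities. -/
theorem trace_adj_mul_adj_mul_adj [MulAction.IsPretransitive G Ω] (x : Ω) (i j k : Fin 4) :
    ∃ m : ℕ, (C.adj i * C.adj j * C.adj k).trace = Fintype.card Ω * C.degAt x k * m := by
  obtain ⟨y₀, x₀, h₀⟩ := C.exists_color k
  refine ⟨(Finset.univ.filter fun z => C.color x₀ z = i ∧ C.color z y₀ = j).card, ?_⟩
  have h1 : ∀ x y, C.color y x = k → (C.adj i * C.adj j) x y =
      ((Finset.univ.filter fun z => C.color x₀ z = i ∧ C.color z y₀ = j).card : ℂ) := by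
    intro x y h
    rw [← h₀, eq_comm, C.color_eq_iff] at h
    obtain ⟨g, rfl, rfl⟩ := h
    rw [(C.isInvariant_adj i).mul (C.isInvariant_adj j)]
    simp only [Matrix.mul_apply, adj_apply, mul_ite, mul_one, mul_zero]
    rw [← Finset.sum_boole]
    refine Finset.sum_congr rfl fun z _ => ?_
    by_cases h1 : C.color x₀ z = i <;> by_cases h2 : C.color z y₀ = j <;> simp [h1, h2]
  have h2 : (C.adj i * C.adj j * C.adj k).trace = ∑ y, ∑ x, (if C.color y x = k then 1 else 0) *
      ((Finset.univ.filter fun z => C.color x₀ z = i ∧ C.color z y₀ = j).card : ℂ) := by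
    rw [Finset.sum_comm]
    simp only [Matrix.trace, Matrix.diag]
    refine Finset.sum_congr rfl fun x _ => ?_
    rw [Matrix.mul_apply]
    refine Finset.sum_congr rfl fun y _ => ?_
    rw [adj_apply]
    split_ifs with h
    · rw [h1 x y h, mul_one, one_mul]
    · simp
  rw [h2]
  simp_rw [← Finset.sum_mul]
  have := C.card_mul_degAt x k
  congr 1
  exact_mod_cast this

/-- The sum of |u x - u y|² over all pairs with label i expands to zero, since row and column sums
both equal the valency. The relation need not be symmetric, so the column sums come from
`degAt_inv`. -/
theorem eq_of_adj_mulVec_eq [MulAction.IsPretransitive G Ω] (a : Ω) {i : Fin 4} {u : Ω → ℂ}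
    (h : C.adj i *ᵥ u = (C.degAt a i : ℂ) • u) {x y : Ω} (hxy : C.color x y = i) : u x = u y := by
  have hrow : ∀ x, ∑ y, C.adj i x y = C.degAt a i := fun x => by
    rw [C.sum_adj_apply, C.degAt_eq x a]
  have hcol : ∀ y, ∑ x, C.adj i x y = C.degAt a i := fun y => by
    rw [← C.degAt_inv, ← C.degAt_eq y a, ← C.sum_adj_apply]
    refine Finset.sum_congr rfl fun x _ => ?_
    rw [adj_apply, adj_apply]
    simp_rw [C.color_swap_eq_iff]
  have hu : ∀ x, ∑ y, C.adj i x y * u y = C.degAt a i * u x := fun x => congrFun h x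
  have hu' : ∀ x, ∑ y, C.adj i x y * star (u y) = C.degAt a i * star (u x) := fun x => by
    have := congrArg star (hu x)
    rw [star_sum, star_mul', star_natCast] at this
    rw [← this]
    refine Finset.sum_congr rfl fun y _ => ?_
    rw [star_mul', adj_apply]
    split_ifs <;> simp
  have h0 : ∑ x, ∑ y, C.adj i x y * ((u x - u y) * star (u x - u y)) = 0 := by
    have h1 : ∀ x y, C.adj i x y * ((u x - u y) * star (u x - u y)) =
        C.adj i x y * (u x * star (u x)) + C.adj i x y * (u y * star (u y)) -
          u x * (C.adj i x y * star (u y)) - star (u x) * (C.adj i x y * u y) := by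
      intro x y
      rw [star_sub]
      ring
    simp_rw [h1, Finset.sum_sub_distrib, Finset.sum_add_distrib, ← Finset.sum_mul, ← Finset.mul_sum,
      hrow, hu, hu']
    rw [Finset.sum_comm]
    simp_rw [← Finset.sum_mul, hcol]
    rw [← Finset.sum_add_distrib, ← Finset.sum_sub_distrib, ← Finset.sum_sub_distrib]
    refine Finset.sum_eq_zero fun x _ => ?_
    ring
  have h2 : ∑ x, ∑ y, (if C.color x y = i then Complex.normSq (u x - u y) else 0) = 0 := by
    rw [← Complex.ofReal_inj, Complex.ofReal_zero, ← h0]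
    push_cast
    refine Finset.sum_congr rfl fun x _ => Finset.sum_congr rfl fun y _ => ?_
    rw [adj_apply]
    split_ifs
    · rw [one_mul]
      exact (Complex.mul_conj _).symm
    · simp
  have h3 : ∀ x y, 0 ≤ (if C.color x y = i then Complex.normSq (u x - u y) else 0) := by
    intro x y
    split_ifs
    · exact Complex.normSq_nonneg _
    · exact le_rfl
  have h4 := (Finset.sum_eq_zero_iff_of_nonneg fun x _ => Finset.sum_nonneg fun y _ => h3 x y).1 h2
    x (Finset.mem_univ x)
  have h5 := (Finset.sum_eq_zero_iff_of_nonneg fun y _ => h3 x y).1 h4 y (Finset.mem_univ y)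
  rw [if_pos hxy, Complex.normSq_eq_zero] at h5
  exact sub_eq_zero.1 h5

/-- In a primitive group, the valency of a nontrivial relation is a simple eigenvalue. -/
theorem eq_of_mulVec_eq_of_isPreprimitive [MulAction.IsPreprimitive G Ω] (a : Ω) {i : Fin 4}
    (hi : i ≠ 0) {u : Ω → ℂ} (h : C.adj i *ᵥ u = (C.degAt a i : ℂ) • u) (x : Ω) : u x = u a := by
  let r : Ω → Ω → Prop := fun x y => ∀ u : Ω → ℂ, C.adj i *ᵥ u = (C.degAt a i : ℂ) • u → u x = u y
  have hr : ∀ (g : G) x y, r x y → r (g • x) (g • y) := by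
    intro g x y hxy u hu
    refine hxy (fun z => u (g • z)) ?_
    have h1 := congrArg (permRep G g⁻¹) hu
    rw [← (C.isInvariant_adj i).mulVec_permRep, map_smul] at h1
    have h2 : permRep G g⁻¹ u = fun z => u (g • z) := by
      funext z
      rw [permRep_apply, _root_.inv_inv]
    rwa [h2] at h1
  have hr' : ∀ (g : G) x y, r (g • x) (g • y) → r x y := by
    intro g x y hxy
    simpa using hr g⁻¹ _ _ hxy
  -- Agreement of all eigenvectors for the valency is a G-invariant equivalence relation, so its
  -- classes are blocks. The class of a contains the points in relation i to a and so has more than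
  -- one element.
  have hblock : MulAction.IsBlock G {y | r y a} := by
    rw [MulAction.isBlock_iff_smul_eq_of_nonempty]
    rintro g ⟨z, hz, hz'⟩
    obtain ⟨b, hb, rfl⟩ := hz
    have hga : r (g • a) a := fun u hu => by rw [← hr g _ _ hb u hu]; exact hz' u hu
    ext w
    rw [Set.mem_smul_set_iff_inv_smul_mem]
    constructor
    · intro hw u hu
      have h1 := hr g _ _ hw u hu
      rw [smul_inv_smul] at h1
      exact h1.trans (hga u hu)
    · intro hw
      refine hr' g _ _ fun u hu => ?_
      rw [smul_inv_smul]
      exact (hw u hu).trans (hga u hu).symm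
  rcases MulAction.IsPreprimitive.isTrivialBlock_of_isBlock hblock with h1 | h1
  · exfalso
    obtain ⟨y, hy⟩ := Finset.card_pos.1 (C.degAt_pos a i)
    have hy := (Finset.mem_filter.1 hy).2
    have : a = y := h1 (fun u _ => rfl) fun u hu => (C.eq_of_adj_mulVec_eq a hu hy).symm
    rw [← this, C.color_self] at hy
    exact hi hy.symm
  · have : x ∈ {y | r y a} := h1 ▸ Set.mem_univ x
    exact this u h

end Adjacency

end Coloring

end PrimitiveDegreeThreeP

/-! ### Integrality and the numerical parameters -/

namespace PrimitiveDegreeThreeP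

open Matrix

set_option linter.unusedSectionVars false

theorem exists_int_eq_of_isIntegral_of_rat {z : ℂ} (hz : IsIntegral ℤ z) {q : ℚ}
    (hq : (q : ℂ) = z) : ∃ n : ℤ, z = n := by
  subst hq
  have h1 : IsIntegral ℤ q := by
    rw [← isIntegral_algebraMap_iff (algebraMap ℚ ℂ).injective]
    simpa using hz
  obtain ⟨n, rfl⟩ := IsIntegrallyClosed.isIntegral_iff.1 h1
  exact ⟨n, by simp⟩

open Polynomial in
-- An irreducible rational polynomial is separable, so having no other conjugate means degree one; a
-- rational algebraic integer is an integer.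
theorem exists_int_eq_of_minpoly_unique {z : ℂ} (hz : IsIntegral ℤ z)
    (h : ∀ w, minpoly ℚ w = minpoly ℚ z → w = z) : ∃ n : ℤ, z = n := by
  have hz' : IsIntegral ℚ z := hz.tower_top
  have hroots : (minpoly ℚ z).rootSet ℂ ⊆ {z} := by
    intro w hw
    have hw' := (mem_rootSet.1 hw).2
    exact h w (minpoly.eq_of_irreducible_of_monic (minpoly.irreducible hz') hw'
      (minpoly.monic hz')).symm
  have hcard := card_rootSet_eq_natDegree (K := ℂ) (minpoly.irreducible hz').separable
    (IsAlgClosed.splits _)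
  have h1 : (minpoly ℚ z).natDegree ≤ 1 := by
    rw [← hcard, ← Nat.card_eq_fintype_card]
    calc _ ≤ Nat.card ({z} : Set ℂ) := Nat.card_mono (Set.finite_singleton z) hroots
      _ = 1 := by simp
  have h2 : (minpoly ℚ z).degree = 1 := by
    rw [← Nat.cast_one, degree_eq_iff_natDegree_eq_of_pos one_pos]
    exact le_antisymm h1 (minpoly.natDegree_pos hz')
  obtain ⟨q, hq⟩ := minpoly.mem_range_of_degree_eq_one ℚ z h2
  exact exists_int_eq_of_isIntegral_of_rat hz (q := q) (by simpa using hq)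

/-- The numerical constraints on the valencies `n` and the eigenvalues `θ`, `φ`, `ψ` (of
multiplicities `p`, `p`, `p - 1`) of the four orbital relations, paired by `inv`. -/
structure Parameters (p : ℕ) (inv : Fin 4 → Fin 4) where
  /-- The valencies. -/
  n : Fin 4 → ℕ
  /-- The eigenvalues on the first constituent of degree `p`. -/
  θ : Fin 4 → ℂ
  /-- The eigenvalues on the second constituent of degree `p`. -/
  φ : Fin 4 → ℂ
  /-- The sums of the eigenvalues on the constituents of degree `p`. -/
  s : Fin 4 → ℤ
  /-- The eigenvalues on the constituent of degree `p - 1`. -/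
  ψ : Fin 4 → ℤ
  add_eq : ∀ i, θ i + φ i = s i
  θ_inv : ∀ i, θ (inv i) = star (θ i)
  φ_inv : ∀ i, φ (inv i) = star (φ i)
  ψ_inv : ∀ i, ψ (inv i) = ψ i
  n_inv : ∀ i, n (inv i) = n i
  n_pos : ∀ i, 0 < n i
  n_zero : n 0 = 1
  ψ_zero : ψ 0 = 1
  sum_n : ∑ i, n i = 3 * p
  sum_ψ : ∑ i, ψ i = 0
  trace_one : ∀ i, i ≠ 0 → (n i : ℤ) + p * s i + (p - 1) * ψ i = 0
  trace_two : ∀ i j, (n i * n j + p * (θ i * θ j) + p * (φ i * φ j) + (p - 1) * (ψ i * ψ j) : ℂ) =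
    if j = inv i then (3 * p * n i : ℂ) else 0
  trace_three : ∀ i j k, ∃ m : ℕ, (n i * n j * n k + p * (θ i * θ j * θ k) +
    p * (φ i * φ j * φ k) + (p - 1) * (ψ i * ψ j * ψ k) : ℂ) = 3 * p * n k * m
  ψ_ne : ∀ i, i ≠ 0 → ψ i ≠ n i

variable {Ω : Type*} [Fintype Ω] [DecidableEq Ω] {G : Subgroup (Equiv.Perm Ω)} {p : ℕ}

namespace Spectrum

variable (S : Spectrum G p) (C : Coloring G)

open Polynomial in
theorem rootMultiplicity_charpoly_adj_eq (i : Fin 4) {z w : ℂ} (h : minpoly ℚ z = minpoly ℚ w) :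
    (C.adj i).charpoly.rootMultiplicity z = (C.adj i).charpoly.rootMultiplicity w := by
  obtain ⟨A, hA⟩ := C.adj_eq_map i
  have h1 : (C.adj i).charpoly = (A.charpoly.map (Int.castRingHom ℚ)).map (algebraMap ℚ ℂ) := by
    rw [hA, Matrix.charpoly_map, Polynomial.map_map]
    congr 1
  rw [h1]
  refine rootMultiplicity_eq_of_minpoly_eq h ?_
  exact ((Matrix.charpoly_monic A).map _).ne_zero

theorem isIntegral_ev_adj (hp : 2 ≤ p) (i j : Fin 4) : IsIntegral ℤ (S.ev j (C.adj i)) := by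
  obtain ⟨A, hA⟩ := C.adj_eq_map i
  obtain ⟨s, rfl⟩ := S.exists_block hp j
  refine ⟨A.charpoly, Matrix.charpoly_monic A, ?_⟩
  have h1 := S.charpoly_eq (C.isInvariant_adj i)
  rw [hA, Matrix.charpoly_map] at h1
  rw [← hA] at h1
  have h2 := congrArg (Polynomial.eval (S.ev (S.block s) (C.adj i))) h1
  rw [Polynomial.eval_map] at h2
  rw [← RingHom.eq_intCast' (algebraMap ℤ ℂ)] at h2
  rw [h2, Polynomial.eval_prod]
  exact Finset.prod_eq_zero (Finset.mem_univ s) (by simp)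

variable [MulAction.IsPretransitive G Ω]

theorem ev_zero_adj (hp : 2 ≤ p) (a : Ω) (i : Fin 4) : S.ev 0 (C.adj i) = C.degAt a i :=
  S.ev_zero hp (C.isInvariant_adj i) fun x => by rw [C.sum_adj_apply, C.degAt_eq x a]

/-- Either the eigenvalue is the valency, or its multiplicity is -1 modulo p. Any other number has
multiplicity 0 or 1 modulo p, which differs from -1 as p ≥ 3, so there is no other conjugate. -/
theorem exists_int_ev_three (hp : 3 ≤ p) (a : Ω) (i : Fin 4) :
    ∃ m : ℤ, S.ev 3 (C.adj i) = m := by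
  by_cases h03 : S.ev 0 (C.adj i) = S.ev 3 (C.adj i)
  · exact ⟨C.degAt a i, by rw [← h03, S.ev_zero_adj C (by omega) a]; simp⟩
  refine exists_int_eq_of_minpoly_unique (S.isIntegral_ev_adj C (by omega) i 3) fun w hw => ?_
  by_contra hne
  have h1 := rootMultiplicity_charpoly_adj_eq C i hw
  rw [S.rootMultiplicity_charpoly (C.isInvariant_adj i),
    S.rootMultiplicity_charpoly (C.isInvariant_adj i), S.card_filter_ev, S.card_filter_ev,
    Fin.sum_univ_four, Fin.sum_univ_four, if_neg h03, if_neg (Ne.symm hne)] at h1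
  have h4 : ∀ j, S.ev j (C.adj i) = w → S.ev j (C.adj i) = S.ev 3 (C.adj i) → False :=
    fun j e1 e2 => hne (e1.symm.trans e2)
  have h5 := h4 1
  have h6 := h4 2
  simp only [Matrix.cons_val, if_true] at h1
  split_ifs at h1 <;> omega

/-- The adjacency matrices add up to the all-ones matrix J. From J² = 3pJ each eigenvalue is 0 or
3p, and the trace 3p is already used up by block 0. -/
theorem ev_sum_adj (hp : 2 ≤ p) (hΩ : Fintype.card Ω = 3 * p) {j : Fin 4} (hj : j ≠ 0) :
    ∑ i, S.ev j (C.adj i) = 0 := by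
  have hinv : IsInvariant G (∑ i, C.adj i) := IsInvariant.sum C.isInvariant_adj
  have h3p : IsInvariant G ((3 * p : ℂ) • ∑ i, C.adj i) := fun g x y => by
    rw [Matrix.smul_apply, Matrix.smul_apply, hinv]
  have hp0 : (p : ℂ) ≠ 0 := by exact_mod_cast (by omega : p ≠ 0)
  have hp1 : (p : ℂ) - 1 ≠ 0 := sub_ne_zero.2 (by exact_mod_cast (by omega : p ≠ 1))
  have h0 : S.ev 0 (∑ i, C.adj i) = 3 * p := by
    refine S.ev_zero hp hinv fun x => ?_
    rw [C.sum_adj]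
    simp [hΩ]
  have hsq : ∀ j, S.ev j (∑ i, C.adj i) = 0 ∨ S.ev j (∑ i, C.adj i) = 3 * p := by
    intro j
    have h1 : (∑ i, C.adj i) * (∑ i, C.adj i) = ((3 * p : ℂ) • 1) * (∑ i, C.adj i) := by
      rw [C.sum_adj]
      ext x y
      simp [Matrix.mul_apply, hΩ, Matrix.one_apply]
    have hone : IsInvariant G ((3 * p : ℂ) • (1 : Matrix Ω Ω ℂ)) := by
      rw [← C.adj_zero]
      intro g x y
      rw [Matrix.smul_apply, Matrix.smul_apply, C.isInvariant_adj]
    have h2 := congrArg (S.ev j) h1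
    rw [S.ev_mul hp hinv hinv, S.ev_mul hp hone hinv, S.ev_smul_one hp _ hone] at h2
    rcases mul_eq_zero.1 (sub_eq_zero.2 h2 ▸ (by ring : (S.ev j (∑ i, C.adj i) - 3 * p) *
      S.ev j (∑ i, C.adj i) = S.ev j (∑ i, C.adj i) * S.ev j (∑ i, C.adj i) - 3 * p *
      S.ev j (∑ i, C.adj i))) with h | h
    · exact Or.inr (sub_eq_zero.1 h)
    · exact Or.inl h
  have htr := S.trace_eq (by omega) hinv
  have htr' : (∑ i, C.adj i).trace = 3 * p := by
    rw [C.sum_adj]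
    simp [Matrix.trace, hΩ]
  rw [htr', h0] at htr
  rw [← S.ev_sum hp C.isInvariant_adj]
  have hp5 : (2 * p : ℂ) - 1 ≠ 0 := sub_ne_zero.2 (by exact_mod_cast (by omega : 2 * p ≠ 1))
  have hp6 : (3 * p : ℂ) - 1 ≠ 0 := sub_ne_zero.2 (by exact_mod_cast (by omega : 3 * p ≠ 1))
  have key : (p : ℂ) * S.ev 1 (∑ i, C.adj i) + p * S.ev 2 (∑ i, C.adj i) +
    (p - 1) * S.ev 3 (∑ i, C.adj i) = 0 := by linear_combination -htr
  rcases hsq 1 with h1 | h1 <;> rcases hsq 2 with h2 | h2 <;> rcases hsq 3 with h3 | h3 <;>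
    rw [h1, h2, h3] at key
  · fin_cases j
    · exact absurd rfl hj
    · exact h1
    · exact h2
    · exact h3
  all_goals
    exfalso
    have : (3 * p : ℂ) * p = 0 ∨ (3 * p : ℂ) * (p - 1) = 0 ∨ (3 * p : ℂ) * (2 * p - 1) = 0 ∨
        (3 * p : ℂ) * (2 * p) = 0 ∨ (3 * p : ℂ) * (3 * p - 1) = 0 := by
      first
      | exact Or.inl (by linear_combination key)
      | exact Or.inr (Or.inl (by linear_combination key))
      | exact Or.inr (Or.inr (Or.inl (by linear_combination key)))
      | exact Or.inr (Or.inr (Or.inr (Or.inl (by linear_combination key))))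
      | exact Or.inr (Or.inr (Or.inr (Or.inr (by linear_combination key))))
    simp [hp0, hp1, hp5, hp6] at this

end Spectrum

/-- Otherwise primitivity makes an eigenvector of block 3 constant, hence proportional to the one of
block 0, against the invertibility of `vec`. -/
theorem Spectrum.ev_three_ne (S : Spectrum G p) (C : Coloring G) [MulAction.IsPreprimitive G Ω] (hp : 2 ≤ p) (a : Ω) {i : Fin 4}
    (hi : i ≠ 0) : S.ev 3 (C.adj i) ≠ C.degAt a i := by
  intro h
  obtain ⟨s, hs⟩ := S.exists_block hp 0
  obtain ⟨t, ht⟩ := S.exists_block hp 3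
  have h1 := S.mulVec_col (C.isInvariant_adj i) t
  rw [ht, h] at h1
  have h2 := C.eq_of_mulVec_eq_of_isPreprimitive a hi h1
  have h3 := congrFun (congrFun S.vecInv_mul_vec t) s
  have h4 := congrFun (congrFun S.vecInv_mul_vec t) t
  have hst : t ≠ s := by
    rintro rfl
    rw [hs] at ht
    exact absurd ht (by decide)
  rw [Matrix.mul_apply, Matrix.one_apply_ne hst] at h3
  rw [Matrix.mul_apply, Matrix.one_apply_eq] at h4
  simp_rw [fun x => S.vec_eq s hs x a, ← Finset.sum_mul] at h3
  simp_rw [h2, ← Finset.sum_mul] at h4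
  rcases mul_eq_zero.1 h3 with h5 | h5
  · rw [h5, zero_mul] at h4
    exact zero_ne_one h4
  · refine S.col_ne_zero s (funext fun x => ?_)
    rw [S.vec_eq s hs x a, h5]
    rfl

theorem exists_parameters (S : Spectrum G p) (C : Coloring G) [MulAction.IsPreprimitive G Ω] (hp : 3 ≤ p)
    (hΩ : Fintype.card Ω = 3 * p) (a : Ω) :
    ∃ P : Parameters p C.inv, ∀ i, P.n i = C.degAt a i := by
  have hp2 : 2 ≤ p := by omega
  have hp0 : (p : ℂ) ≠ 0 := by exact_mod_cast (by omega : p ≠ 0)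
  choose ψ hψ using fun i => S.exists_int_ev_three C hp a i
  have hI := C.isInvariant_adj
  have hzero : ∀ j, S.ev j (C.adj 0) = 1 := fun j => by
    have h := S.ev_smul_one hp2 1 (by simpa [C.adj_zero] using hI 0) j
    rwa [one_smul, ← C.adj_zero] at h
  have hdeg := S.ev_zero_adj C hp2 a
  have ht1 : ∀ i, i ≠ 0 → (C.degAt a i : ℂ) + p * (S.ev 1 (C.adj i) + S.ev 2 (C.adj i)) +
      (p - 1) * ψ i = 0 := by
    intro i hi
    have h := S.trace_eq (by omega) (hI i)
    rw [C.trace_adj hi, hdeg, hψ] at h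
    linear_combination -h
  have hs : ∀ i, ∃ s : ℤ, S.ev 1 (C.adj i) + S.ev 2 (C.adj i) = s := by
    intro i
    by_cases hi : i = 0
    · subst hi
      exact ⟨2, by rw [hzero, hzero]; norm_num⟩
    · refine exists_int_eq_of_isIntegral_of_rat
        ((S.isIntegral_ev_adj C hp2 i 1).add (S.isIntegral_ev_adj C hp2 i 2))
        (q := -(C.degAt a i + (p - 1) * ψ i) / p) ?_
      push_cast
      rw [div_eq_iff hp0]
      linear_combination -ht1 i hi
  choose s hs using hs
  have hstar : ∀ j i, S.ev j (C.adj (C.inv i)) = star (S.ev j (C.adj i)) := fun j i => by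
    rw [← C.conjTranspose_adj, S.ev_conjTranspose hp2 (hI i)]
  refine ⟨{
    n := C.degAt a
    θ := fun i => S.ev 1 (C.adj i)
    φ := fun i => S.ev 2 (C.adj i)
    s := s
    ψ := ψ
    add_eq := hs
    θ_inv := hstar 1
    φ_inv := hstar 2
    ψ_inv := fun i => ?_
    n_inv := C.degAt_inv a
    n_pos := C.degAt_pos a
    n_zero := C.degAt_zero a
    ψ_zero := ?_
    sum_n := ?_
    sum_ψ := ?_
    trace_one := fun i hi => ?_
    trace_two := fun i j => ?_
    trace_three := fun i j k => ?_
    ψ_ne := fun i hi h => ?_ }, fun _ => rfl⟩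
  · have h := hstar 3 i
    rw [hψ, hψ] at h
    simpa using h
  · have h := hzero 3
    rw [hψ] at h
    exact_mod_cast h
  · rw [C.sum_degAt, hΩ]
  · have h := S.ev_sum_adj C hp2 hΩ (j := 3) (by decide)
    simp_rw [hψ] at h
    exact_mod_cast h
  · have h := ht1 i hi
    rw [hs] at h
    exact_mod_cast h
  · have h := S.trace_eq (by omega) ((hI i).mul (hI j))
    rw [C.trace_adj_mul_adj a, hΩ] at h
    simp_rw [S.ev_mul hp2 (hI i) (hI j), hdeg, hψ] at h
    rw [← h]
    push_cast
    rfl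
  · obtain ⟨m, hm⟩ := C.trace_adj_mul_adj_mul_adj a i j k
    refine ⟨m, ?_⟩
    have h := S.trace_eq (by omega) (((hI i).mul (hI j)).mul (hI k))
    simp_rw [S.ev_mul hp2 ((hI i).mul (hI j)) (hI k), S.ev_mul hp2 (hI i) (hI j), hdeg, hψ] at h
    rw [← h, hm, hΩ]
    push_cast
    rfl
  · refine S.ev_three_ne C hp2 a hi ?_
    rw [hψ, h]
    simp

end PrimitiveDegreeThreeP

/-! ### Arithmetic of the parameters -/

namespace PrimitiveDegreeThreeP

set_option linter.unusedSectionVars false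

namespace Parameters

variable {p : ℕ} {inv : Fin 4 → Fin 4} (P : Parameters p inv)

/-- Minus the trace, per multiplicity, on the nontrivial constituents. -/
def k (i : Fin 4) : ℤ := -(P.s i + P.ψ i)

theorem n_eq {i : Fin 4} (hi : i ≠ 0) : (P.n i : ℤ) = P.ψ i + p * P.k i := by
  rw [k]
  linear_combination P.trace_one i hi

theorem k_ne_zero {i : Fin 4} (hi : i ≠ 0) : P.k i ≠ 0 := by
  intro h
  have h1 := P.n_eq hi
  rw [h] at h1
  exact P.ψ_ne i hi (by linarith)

theorem sum_ψ_eq : P.ψ 1 + P.ψ 2 + P.ψ 3 = -1 := by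
  have h := P.sum_ψ
  rw [Fin.sum_univ_four, P.ψ_zero] at h
  linarith

theorem sum_k (hp : 0 < p) : P.k 1 + P.k 2 + P.k 3 = 3 := by
  have h := P.sum_n
  rw [Fin.sum_univ_four, P.n_zero] at h
  have h1 : (1 + P.n 1 + P.n 2 + P.n 3 : ℤ) = 3 * p := by exact_mod_cast h
  rw [P.n_eq (i := 1) (by decide), P.n_eq (i := 2) (by decide), P.n_eq (i := 3) (by decide)] at h1
  have hp' : (p : ℤ) ≠ 0 := by exact_mod_cast hp.ne'
  exact mul_left_cancel₀ hp' (by linear_combination h1 - P.sum_ψ_eq)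

/-- The product of the differences of the eigenvalues of two relations. -/
def diffProd (i j : Fin 4) : ℤ :=
  (if j = inv i then 6 * (P.n i : ℤ) else 0) - 3 * P.ψ i * P.ψ j - 3 * P.ψ i * P.k j -
    3 * P.ψ j * P.k i - (2 * p + 1) * (P.k i * P.k j)

/-- The identity (θ - φ)(θ' - φ') = 2(θθ' + φφ') - (θ + φ)(θ' + φ'), with the first sum given by
`trace_two`. -/
theorem diff_mul_diff (hp : 0 < p) {i j : Fin 4} (hi : i ≠ 0) (hj : j ≠ 0) :
    (P.θ i - P.φ i) * (P.θ j - P.φ j) = P.diffProd i j := by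
  have hp' : (p : ℂ) ≠ 0 := by exact_mod_cast hp.ne'
  have h1 : (P.n i : ℂ) = P.ψ i + p * P.k i := by exact_mod_cast P.n_eq hi
  have h2 : (P.n j : ℂ) = P.ψ j + p * P.k j := by exact_mod_cast P.n_eq hj
  have hs : ∀ i, P.θ i + P.φ i = -(P.k i + P.ψ i) := fun i => by
    rw [P.add_eq, k]
    push_cast
    ring
  have h3 := P.trace_two i j
  have h4 : (if j = inv i then 3 * p * P.n i else 0 : ℂ) =
      3 * p * ((if j = inv i then (P.n i : ℤ) else 0 : ℤ) : ℂ) := by split_ifs <;> simp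
  have h5 : (if j = inv i then 6 * (P.n i : ℤ) else 0 : ℤ) =
      6 * (if j = inv i then (P.n i : ℤ) else 0 : ℤ) := by split_ifs <;> simp
  rw [h4] at h3
  rw [diffProd, h5]
  generalize (if j = inv i then (P.n i : ℤ) else 0 : ℤ) = δ at h3 ⊢
  rw [h1, h2] at h3
  refine mul_left_cancel₀ hp' ?_
  push_cast
  linear_combination 2 * h3 - p * (P.θ j + P.φ j) * hs i + p * (P.k i + P.ψ i) * hs j

theorem eq_re_of_inv_eq {i : Fin 4} (h : inv i = i) :
    P.θ i - P.φ i = ((P.θ i - P.φ i).re : ℂ) := by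
  have h1 := P.θ_inv i
  have h2 := P.φ_inv i
  rw [h] at h1 h2
  refine (Complex.conj_eq_iff_re.1 ?_).symm
  rw [map_sub]
  exact congrArg₂ (· - ·) h1.symm h2.symm

theorem diffProd_self_nonneg (hp : 0 < p) {i : Fin 4} (hi : i ≠ 0) (h : inv i = i) :
    0 ≤ P.diffProd i i := by
  have h1 := P.diff_mul_diff hp hi hi
  rw [P.eq_re_of_inv_eq h] at h1
  have h2 : (P.θ i - P.φ i).re * (P.θ i - P.φ i).re = P.diffProd i i := by exact_mod_cast h1
  exact_mod_cast h2 ▸ mul_self_nonneg _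

/-- For a self-paired orbital θ - φ is real, so its square is nonnegative. Completing the square
bounds 3(ψ + k - 1)² by 2(p - 1)k(3 - k) + 3, which forces 0 ≤ k ≤ 3; and k ≠ 0. -/
theorem one_le_k (hp : 5 ≤ p) {i : Fin 4} (hi : i ≠ 0) (h : inv i = i) :
    1 ≤ P.k i ∧ P.k i ≤ 3 := by
  have h1 := P.diffProd_self_nonneg (by omega) hi h
  rw [diffProd, if_pos h.symm, P.n_eq hi] at h1
  have h2 : 3 * (P.ψ i + P.k i - 1) ^ 2 ≤ 2 * (p - 1) * (P.k i * (3 - P.k i)) + 3 := by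
    linear_combination h1
  have hp' : (5 : ℤ) ≤ p := by exact_mod_cast hp
  have h3 : 0 ≤ P.k i * (3 - P.k i) := by
    by_contra! hneg
    nlinarith [sq_nonneg (P.ψ i + P.k i - 1)]
  have h4 := P.k_ne_zero hi
  constructor
  · by_contra! h5
    have : P.k i ≤ -1 := by omega
    nlinarith
  · by_contra! h5
    nlinarith

/-- `trace_three` for i, j, j, rewritten through sums s and differences d: 4(θθ'² + φφ'²) = s(s'² +
d'²) + 2dd's'. -/
theorem trace_three_diff (hp : 0 < p) {i j : Fin 4} (hi : i ≠ 0) (hj : j ≠ 0) :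
    ∃ m : ℤ, 4 * (P.n i * P.n j ^ 2 + (p - 1) * (P.ψ i * P.ψ j ^ 2)) +
      p * (P.s i * (P.s j ^ 2 + P.diffProd j j) + 2 * P.diffProd i j * P.s j) =
      12 * p * P.n j * m := by
  obtain ⟨m, hm⟩ := P.trace_three i j j
  refine ⟨m, ?_⟩
  have h1 := P.diff_mul_diff hp hj hj
  have h2 := P.diff_mul_diff hp hi hj
  have hsi := P.add_eq i
  have hsj := P.add_eq j
  have : (4 * (P.n i * P.n j ^ 2 + (p - 1) * (P.ψ i * P.ψ j ^ 2)) +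
      p * (P.s i * (P.s j ^ 2 + P.diffProd j j) + 2 * P.diffProd i j * P.s j) : ℂ) =
      12 * p * P.n j * m := by
    rw [← h1, ← h2, ← hsi, ← hsj]
    linear_combination 4 * hm
  exact_mod_cast this

/-- Dividing the cubic trace identity by 8(2r + 1) leaves w(4w - 1)(3v - 1) = (r + w)(3m - (2r + 4w
- 1)). -/
theorem isAdmissible_dvd {r v w ψ ψ' s s' n n' D D' m : ℤ} (hr : 2 * r + 1 ≠ 0)
    (hψ : ψ = 2 * v - 1) (hψ' : ψ' = 2 * w - 1) (hs : s = -(2 * v)) (hs' : s' = -(2 * w))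
    (hn : n = 2 * (r + v)) (hn' : n' = 2 * (r + w)) (hD : D = 8 * r - 12 * w ^ 2 + 12 * w)
    (hD' : D' = -4 * r - 12 * v * w)
    (h : 4 * (n * n' ^ 2 + (2 * r + 1 - 1) * (ψ * ψ' ^ 2)) +
      (2 * r + 1) * (s * (s' ^ 2 + D) + 2 * D' * s') = 12 * (2 * r + 1) * n' * m) :
    r + w ∣ w * (4 * w - 1) * (3 * v - 1) := by
  subst hψ hψ' hs hs' hn hn' hD hD'
  refine ⟨3 * m - (2 * r + 4 * w - 1), ?_⟩
  refine mul_left_cancel₀ (mul_ne_zero (by norm_num : (8 : ℤ) ≠ 0) hr) ?_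
  linear_combination h

/-- After division by p the identity modulo 4 reduces to 2(1 + ψ)(1 + ψ') ≡ 0. -/
theorem even_mul_of_trace {p ψ ψ' s s' n n' D D' m : ℤ} (hp : p ≠ 0)
    (hs : s = -(1 + ψ)) (hs' : s' = -(1 + ψ')) (hn : n = ψ + p) (hn' : n' = ψ' + p)
    (hD : D = 4 * p - 1 - 3 * ψ' ^ 2) (hD' : D' = 2 - 2 * p - 3 * (1 + ψ) * (1 + ψ'))
    (h : 4 * (n * n' ^ 2 + (p - 1) * (ψ * ψ' ^ 2)) +
      p * (s * (s' ^ 2 + D) + 2 * D' * s') = 12 * p * n' * m) :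
    Even ((1 + ψ) * (1 + ψ')) := by
  subst hs hs' hn hn' hD hD'
  have h1 : 4 * (ψ * ψ' ^ 2 + 2 * ψ * ψ' + p * ψ + ψ' ^ 2 + 2 * p * ψ' + p ^ 2) -
      (1 + ψ) * ((1 + ψ') ^ 2 + 4 * p - 1 - 3 * ψ' ^ 2) -
      2 * (1 + ψ') * (2 - 2 * p - 3 * (1 + ψ) * (1 + ψ')) = 12 * (ψ' + p) * m := by
    refine mul_left_cancel₀ hp ?_
    linear_combination h
  obtain ⟨a, ha⟩ : ∃ a, a = 1 + ψ := ⟨_, rfl⟩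
  obtain ⟨b, hb⟩ : ∃ b, b = 1 + ψ' := ⟨_, rfl⟩
  obtain rfl : ψ = a - 1 := by omega
  obtain rfl : ψ' = b - 1 := by omega
  have h2 : ∃ c, 2 * (a * b) = 4 * c := by
    refine ⟨3 * (b - 1 + p) * m - ((a - 1) * (b - 1) ^ 2 + 2 * (a - 1) * (b - 1) + p * (a - 1) +
      (b - 1) ^ 2 + 2 * p * (b - 1) + p ^ 2) + a * (p - 1) + b * (1 - p) - 2 * a * b ^ 2 +
      2 * a * b, ?_⟩
    linear_combination h1
  obtain ⟨c, hc⟩ := h2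
  rw [add_sub_cancel, add_sub_cancel]
  exact ⟨c, by linarith⟩

theorem false_of_inv_eq (P : Parameters p inv) (hp : 5 ≤ p) (hodd : Odd p) (h : ∀ i, inv i = i) : False := by
  have hp0 : 0 < p := by omega
  have hk : ∀ i, i ≠ 0 → P.k i = 1 := by
    have h1 := P.one_le_k hp (i := 1) (by decide) (h 1)
    have h2 := P.one_le_k hp (i := 2) (by decide) (h 2)
    have h3 := P.one_le_k hp (i := 3) (by decide) (h 3)
    have h4 := P.sum_k hp0
    intro i hi
    fin_cases i
    · exact absurd rfl hi
    all_goals simp only [Fin.mk_one, Fin.reduceFinMk]; omega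
  have hs : ∀ i, i ≠ 0 → P.s i = -(1 + P.ψ i) := fun i hi => by
    have := hk i hi
    rw [k] at this
    linarith
  have hn : ∀ i, i ≠ 0 → (P.n i : ℤ) = P.ψ i + p := fun i hi => by
    rw [P.n_eq hi, hk i hi, mul_one]
  have hD : ∀ i, i ≠ 0 → P.diffProd i i = 4 * p - 1 - 3 * P.ψ i ^ 2 := fun i hi => by
    rw [diffProd, if_pos (h i).symm, hn i hi, hk i hi]
    ring
  have hD' : ∀ i j, i ≠ 0 → j ≠ 0 → i ≠ j →
      P.diffProd i j = 2 - 2 * p - 3 * (1 + P.ψ i) * (1 + P.ψ j) := fun i j hi hj hij => by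
    rw [diffProd, if_neg (by rw [h]; exact hij.symm), hk i hi, hk j hj]
    ring
  have hpz : (p : ℤ) ≠ 0 := by exact_mod_cast hp0.ne'
  have heven : ∀ i j, i ≠ 0 → j ≠ 0 → i ≠ j → Even ((1 + P.ψ i) * (1 + P.ψ j)) := by
    intro i j hi hj hij
    obtain ⟨m, hm⟩ := P.trace_three_diff hp0 hi hj
    exact even_mul_of_trace hpz (hs i hi) (hs j hj) (hn i hi) (hn j hj) (hD j hj)
      (hD' i j hi hj hij) hm
  have h12 := heven 1 2 (by decide) (by decide) (by decide)
  have h13 := heven 1 3 (by decide) (by decide) (by decide)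
  have h23 := heven 2 3 (by decide) (by decide) (by decide)
  have hsum := P.sum_ψ_eq
  have hv : ∀ i, i ≠ 0 → ∃ v, P.ψ i = 2 * v - 1 := by
    -- Evenness of the pairwise products allows at most one odd number among the 1 + ψ i; their sum
    -- is 2, so none is odd.
    have hall : Even (1 + P.ψ 1) ∧ Even (1 + P.ψ 2) ∧ Even (1 + P.ψ 3) := by
      have hsum' : Even ((1 + P.ψ 1) + (1 + P.ψ 2) + (1 + P.ψ 3)) := ⟨1, by linarith⟩
      simp only [Int.even_mul, Int.even_add (m := 1 + P.ψ 1 + (1 + P.ψ 2)),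
        Int.even_add (m := 1 + P.ψ 1) (n := 1 + P.ψ 2)] at h12 h13 h23 hsum'
      tauto
    intro i hi
    have : Even (1 + P.ψ i) := by
      fin_cases i
      · exact absurd rfl hi
      · exact hall.1
      · exact hall.2.1
      · exact hall.2.2
    obtain ⟨v, hv⟩ := this
    exact ⟨v, by linarith⟩
  obtain ⟨r, hr⟩ := hodd
  have hpr : (p : ℤ) = 2 * r + 1 := by exact_mod_cast hr
  have hdvd : ∀ i j v w, i ≠ 0 → j ≠ 0 → i ≠ j → P.ψ i = 2 * v - 1 → P.ψ j = 2 * w - 1 →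
      (r : ℤ) + w ∣ w * (4 * w - 1) * (3 * v - 1) := by
    intro i j v w hi hj hij hv hw
    obtain ⟨m, hm⟩ := P.trace_three_diff hp0 hi hj
    rw [hpr] at hm
    refine isAdmissible_dvd (hpr ▸ hpz) hv hw ?_ ?_ ?_ ?_ ?_ ?_ hm
    · rw [hs i hi, hv]; ring
    · rw [hs j hj, hw]; ring
    · rw [hn i hi, hv, hpr]; ring
    · rw [hn j hj, hw, hpr]; ring
    · rw [hD j hj, hw, hpr]; ring
    · rw [hD' i j hi hj hij, hv, hw, hpr]; ring
  have hpos : ∀ i v, i ≠ 0 → P.ψ i = 2 * v - 1 → 0 < (r : ℤ) + v := by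
    intro i v hi hv
    have h1 := hn i hi
    have h2 : (0 : ℤ) < P.n i := by exact_mod_cast P.n_pos i
    rw [hv, hpr] at h1
    linarith
  have hbound : ∀ i v, i ≠ 0 → P.ψ i = 2 * v - 1 → 3 * v ^ 2 - 3 * v ≤ 2 * (r : ℤ) := by
    intro i v hi hv
    have h1 := P.diffProd_self_nonneg hp0 hi (h i)
    rw [hD i hi, hv, hpr] at h1
    linarith
  obtain ⟨x, hx⟩ := hv 1 (by decide)
  obtain ⟨y, hy⟩ := hv 2 (by decide)
  obtain ⟨z, hz⟩ := hv 3 (by decide)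
  have hxyz : x + y + z = 1 := by
    rw [hx, hy, hz] at hsum
    linarith
  have hadm : IsAdmissible r x y z := by
    refine ⟨hxyz, ?_, hdvd 2 1 y x ?_ ?_ ?_ hy hx, hdvd 3 1 z x ?_ ?_ ?_ hz hx,
      hdvd 1 2 x y ?_ ?_ ?_ hx hy, hdvd 3 2 z y ?_ ?_ ?_ hz hy, hdvd 1 3 x z ?_ ?_ ?_ hx hz,
      hdvd 2 3 y z ?_ ?_ ?_ hy hz⟩
    rotate_left
    iterate 18 decide
    -- The cubic relation expresses (d₁d₂)² = d₁²d₂² for the differences d = θ - φ, divided by 48.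
    have e1 := P.diff_mul_diff hp0 (i := 1) (j := 1) (by decide) (by decide)
    have e2 := P.diff_mul_diff hp0 (i := 2) (j := 2) (by decide) (by decide)
    have e3 := P.diff_mul_diff hp0 (i := 1) (j := 2) (by decide) (by decide)
    have e4 : (P.diffProd 1 2 * P.diffProd 1 2 : ℂ) = P.diffProd 1 1 * P.diffProd 2 2 := by
      rw [← e1, ← e2, ← e3]
      ring
    have e5 : P.diffProd 1 2 * P.diffProd 1 2 = P.diffProd 1 1 * P.diffProd 2 2 := by
      exact_mod_cast e4
    rw [hD 1 (by decide), hD 2 (by decide), hD' 1 2 (by decide) (by decide) (by decide),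
      hx, hy, hpr] at e5
    obtain rfl : z = 1 - x - y := by linarith
    refine mul_left_cancel₀ (by norm_num : (48 : ℤ) ≠ 0) ?_
    linear_combination (-1) * e5
  exact hadm.false (by omega) (hpos 1 x (by decide) hx) (hpos 2 y (by decide) hy)
    (hpos 3 z (by decide) hz) (hbound 1 x (by decide) hx) (hbound 2 y (by decide) hy)
    (hbound 3 z (by decide) hz)

theorem exists_eq_of_inv_swap (hp : 5 ≤ p) (h1 : inv 1 = 1) (h2 : inv 2 = 3) :
    ∃ a : ℕ, p = 3 * a ^ 2 + 3 * a + 1 ∧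
      ((Even a ∧ (P.n 1 : ℤ) = p - 2 * a - 1 ∧ (P.n 2 : ℤ) = p + a ∧ (P.n 3 : ℤ) = p + a) ∨
        (Odd a ∧ (P.n 1 : ℤ) = p + 2 * a + 1 ∧ (P.n 2 : ℤ) = p - a - 1 ∧
          (P.n 3 : ℤ) = p - a - 1)) := by
  have hp0 : 0 < p := by omega
  have hpz : (p : ℤ) ≠ 0 := by exact_mod_cast hp0.ne'
  have hψ : P.ψ 3 = P.ψ 2 := h2 ▸ P.ψ_inv 2
  have hnn : P.n 3 = P.n 2 := h2 ▸ P.n_inv 2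
  have hn1 := P.n_eq (i := 1) (by decide)
  have hn2 := P.n_eq (i := 2) (by decide)
  have hn3 := P.n_eq (i := 3) (by decide)
  have hk32 : P.k 3 = P.k 2 := by
    rw [hnn, hψ, hn2] at hn3
    exact mul_left_cancel₀ hpz (by linarith)
  -- k 1 + 2 k 2 = 3 with 1 ≤ k 1 ≤ 3 and k 2 ≠ 0.
  have hk2 : P.k 2 = 1 := by
    have e1 := P.one_le_k hp (i := 1) (by decide) h1
    have e2 := P.sum_k hp0
    have e3 := P.k_ne_zero (i := 2) (by decide)
    omega
  have hk1 : P.k 1 = 1 := by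
    have e2 := P.sum_k hp0
    omega
  have hsum := P.sum_ψ_eq
  rw [hψ] at hsum
  set y := P.ψ 2 with hy
  have hψ1 : P.ψ 1 = -1 - 2 * y := by linarith
  rw [hk1, hψ1] at hn1
  rw [hk2] at hn2
  have hp1 : (5 : ℤ) ≤ p := by exact_mod_cast hp
  -- the difference of the eigenvalues of a relation that is not self-paired is purely imaginary
  have hd22 : P.diffProd 2 2 = -3 * (y + 1) ^ 2 - (2 * p - 2) := by
    rw [diffProd, if_neg (by rw [h2]; decide), hk2]
    ring
  have hd2 := P.diff_mul_diff hp0 (i := 2) (j := 2) (by decide) (by decide)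
  have hneg : P.diffProd 2 2 < 0 := by
    rw [hd22]
    nlinarith [sq_nonneg (y + 1)]
  have hnegR : (P.diffProd 2 2 : ℝ) < 0 := by exact_mod_cast hneg
  have hre := congrArg Complex.re hd2
  have him := congrArg Complex.im hd2
  rw [Complex.mul_re, Complex.intCast_re] at hre
  rw [Complex.mul_im, Complex.intCast_im] at him
  set z := P.θ 2 - P.φ 2 with hz
  have hzim : z.im ≠ 0 := by
    intro h0
    rw [h0] at hre
    nlinarith [mul_self_nonneg z.re]
  have hzre : z.re = 0 := by
    have : z.re * z.im = 0 := by linarith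
    exact (mul_eq_zero.1 this).resolve_right hzim
  -- A real number times a nonzero imaginary one is an integer here, so the real factor is zero.
  have hd1 : P.θ 1 - P.φ 1 = 0 := by
    have e1 := P.diff_mul_diff hp0 (i := 1) (j := 2) (by decide) (by decide)
    rw [P.eq_re_of_inv_eq h1] at e1
    have e2 := congrArg Complex.im e1
    rw [Complex.im_ofReal_mul, Complex.intCast_im] at e2
    rw [P.eq_re_of_inv_eq h1, (mul_eq_zero.1 e2).resolve_right hzim, Complex.ofReal_zero]
  have hd11 : P.diffProd 1 1 = 0 := by
    have e1 := P.diff_mul_diff hp0 (i := 1) (j := 1) (by decide) (by decide)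
    rw [hd1, zero_mul] at e1
    exact_mod_cast e1.symm
  rw [diffProd, if_pos h1.symm, hn1, hk1, hψ1] at hd11
  have hpy : (p : ℤ) = 3 * y ^ 2 + 3 * y + 1 := by linarith
  have hconj : star (P.θ 2) = P.φ 2 ∧ star (P.φ 2) = P.θ 2 := by
    have e1 := P.add_eq 2
    have e2 := congrArg Complex.im e1
    rw [Complex.add_im, Complex.intCast_im] at e2
    rw [hz, Complex.sub_re] at hzre
    constructor
    · apply Complex.ext
      · simp only [Complex.star_def, Complex.conj_re]; linarith
      · simp only [Complex.star_def, Complex.conj_im]; linarith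
    · apply Complex.ext
      · simp only [Complex.star_def, Complex.conj_re]; linarith
      · simp only [Complex.star_def, Complex.conj_im]; linarith
  have hθ3 : P.θ 3 = P.φ 2 := by rw [← hconj.1, ← P.θ_inv, h2]
  have hφ3 : P.φ 3 = P.θ 2 := by rw [← hconj.2, ← P.φ_inv, h2]
  -- Cancelling 6p(y + p) from this trace leaves y(2y + 3) = 2m, which makes y even.
  obtain ⟨m, hm⟩ := P.trace_three 2 2 3
  have hs2 : P.s 2 = -(1 + y) := by
    rw [k] at hk2
    linarith
  have htr : 4 * (P.n 2 ^ 3 + (p - 1) * y ^ 3) +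
      p * (P.s 2 * (P.s 2 ^ 2 - P.diffProd 2 2)) = 12 * p * P.n 2 * (m : ℤ) := by
    have : (4 * (P.n 2 ^ 3 + (p - 1) * y ^ 3) +
        p * (P.s 2 * (P.s 2 ^ 2 - P.diffProd 2 2)) : ℂ) = 12 * p * P.n 2 * (m : ℤ) := by
      rw [hθ3, hφ3, hnn, hψ] at hm
      rw [← hd2, ← P.add_eq 2, hz, Int.cast_natCast]
      linear_combination 4 * hm
    exact_mod_cast this
  rw [hd22, hs2, hn2] at htr
  have htr' : (y * (2 * y + 3)) * (p * (y + p)) = (2 * m) * (p * (y + p)) := by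
    rw [hpy] at htr ⊢
    refine mul_left_cancel₀ (by norm_num : (6 : ℤ) ≠ 0) ?_
    linear_combination htr
  have hm2 : y * (2 * y + 3) = 2 * m := by
    refine mul_right_cancel₀ (mul_ne_zero hpz ?_) htr'
    have : (0 : ℤ) < P.n 2 := by exact_mod_cast P.n_pos 2
    linarith
  have hyeven : Even y := by
    have : Even (y * (2 * y + 3)) := ⟨m, by linarith⟩
    rcases Int.even_mul.1 this with e | e
    · exact e
    · exact absurd e (by rw [Int.not_even_iff_odd]; exact ⟨y + 1, by ring⟩)
  rw [hnn]
  -- 3y² + 3y + 1 is invariant under y ↦ -1 - y, so a is y or -1 - y; the second choice turns even y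
  -- into odd a.
  by_cases hy0 : 0 ≤ y
  · obtain ⟨a, ha⟩ := Int.eq_ofNat_of_zero_le hy0
    rw [ha] at hpy hn1 hn2 hyeven
    refine ⟨a, by exact_mod_cast hpy, Or.inl ⟨by exact_mod_cast hyeven, ?_, ?_, ?_⟩⟩ <;> linarith
  · obtain ⟨a, ha⟩ : ∃ a : ℕ, y = -(a + 1 : ℤ) := ⟨(-y - 1).toNat, by omega⟩
    rw [ha] at hpy hn1 hn2 hyeven
    refine ⟨a, ?_, Or.inr ⟨?_, ?_, ?_, ?_⟩⟩
    · zify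
      linarith
    · rw [even_neg, Int.even_add_one, Int.not_even_iff_odd] at hyeven
      exact_mod_cast hyeven
    all_goals linarith

end Parameters

end PrimitiveDegreeThreeP

/-! ### Suborbits, pairing and relabelling -/

namespace PrimitiveDegreeThreeP

set_option linter.unusedSectionVars false

namespace Coloring

variable {Ω : Type*} {G : Subgroup (Equiv.Perm Ω)} (C : Coloring G)

/-- The same orbits with permuted labels. -/
def relabel (σ : Equiv.Perm (Fin 4)) (hσ : σ 0 = 0) : Coloring G where
  color x y := σ (C.color x y)
  color_eq_iff x y x' y' := by rw [σ.injective.eq_iff, C.color_eq_iff]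
  color_self x := by rw [C.color_self, hσ]
  exists_color i := by
    obtain ⟨x, y, h⟩ := C.exists_color (σ.symm i)
    exact ⟨x, y, by rw [h, σ.apply_symm_apply]⟩

theorem relabel_inv (σ : Equiv.Perm (Fin 4)) (hσ : σ 0 = 0) (i : Fin 4) :
    (C.relabel σ hσ).inv (σ i) = σ (C.inv i) := by
  obtain ⟨x, y, rfl⟩ := C.exists_color i
  rw [← C.color_swap]
  exact ((C.relabel σ hσ).color_swap x y).symm

/-- Pairing is an involution fixing 0, hence the identity or a transposition of 1, 2, 3, which a
relabelling makes the one exchanging 2 and 3. -/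
theorem exists_inv_eq (C : Coloring G) :
    ∃ C : Coloring G, (∀ i, C.inv i = i) ∨ (C.inv 1 = 1 ∧ C.inv 2 = 3) := by
  have h0 := C.inv_zero
  have key : ∀ b c d : Fin 4, (∀ i, (![0, b, c, d] : Fin 4 → Fin 4) (![0, b, c, d] i) = i) →
      (b = 1 ∧ c = 2 ∧ d = 3) ∨ (b = 1 ∧ c = 3) ∨ (c = 2 ∧ b = 3) ∨ (d = 3 ∧ c = 1) := by decide
  have hvec : C.inv = ![0, C.inv 1, C.inv 2, C.inv 3] := by
    funext i
    fin_cases i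
    · exact h0
    all_goals rfl
  rcases key _ _ _ fun i => by rw [← hvec, C.inv_inv] with h | h | ⟨h1, h2⟩ | ⟨h1, h2⟩
  · refine ⟨C, Or.inl fun i => ?_⟩
    fin_cases i
    exacts [h0, h.1, h.2.1, h.2.2]
  · exact ⟨C, Or.inr h⟩
  · refine ⟨C.relabel (Equiv.swap 1 2) (by decide), Or.inr ⟨?_, ?_⟩⟩
    · have := C.relabel_inv (Equiv.swap 1 2) (by decide) 2
      rwa [h1] at this
    · have := C.relabel_inv (Equiv.swap 1 2) (by decide) 1
      rwa [h2] at this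
  · refine ⟨C.relabel (Equiv.swap 1 3) (by decide), Or.inr ⟨?_, ?_⟩⟩
    · have := C.relabel_inv (Equiv.swap 1 3) (by decide) 3
      rwa [h1] at this
    · have := C.relabel_inv (Equiv.swap 1 3) (by decide) 2
      rwa [h2] at this

/-- The suborbit with a given label. -/
def suborbit (a : Ω) (i : Fin 4) : Set Ω := {b | C.color a b = i}

theorem suborbit_zero (a : Ω) : C.suborbit a 0 = {a} := by
  ext b
  rw [suborbit, Set.mem_ofPred_eq, C.color_eq_zero_iff, Set.mem_singleton_iff, eq_comm]

variable [MulAction.IsPretransitive G Ω]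

theorem exists_mem_suborbit (a : Ω) (i : Fin 4) : ∃ b, C.color a b = i := by
  obtain ⟨x, y, h⟩ := C.exists_color i
  obtain ⟨g, rfl⟩ := MulAction.exists_smul_eq G x a
  exact ⟨g • y, by rw [C.color_smul, h]⟩

theorem suborbit_injective (a : Ω) : Function.Injective (C.suborbit a) := by
  intro i j h
  obtain ⟨b, hb⟩ := C.exists_mem_suborbit a i
  have : b ∈ C.suborbit a j := h ▸ hb
  exact hb.symm.trans this

theorem orbit_stabilizer_eq (a b : Ω) :
    MulAction.orbit (MulAction.stabilizer G a) b = C.suborbit a (C.color a b) := by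
  ext c
  rw [suborbit, Set.mem_ofPred_eq, eq_comm, C.color_eq_iff, MulAction.mem_orbit_iff]
  exact ⟨fun ⟨g, hg⟩ => ⟨g, g.2, hg⟩, fun ⟨g, h1, h2⟩ => ⟨⟨g, h1⟩, h2⟩⟩

theorem range_suborbit (a : Ω) : Set.range (C.suborbit a) = suborbits G a := by
  ext s
  constructor
  · rintro ⟨i, rfl⟩
    obtain ⟨b, rfl⟩ := C.exists_mem_suborbit a i
    exact ⟨b, (C.orbit_stabilizer_eq a b).symm⟩
  · rintro ⟨b, rfl⟩
    exact ⟨_, (C.orbit_stabilizer_eq a b).symm⟩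

theorem orbital_suborbit (a : Ω) (i : Fin 4) :
    orbital G a (C.suborbit a i) = {x | C.color x.1 x.2 = i} := by
  ext ⟨x, y⟩
  constructor
  · rintro ⟨g, b, hb, h⟩
    rw [h, Set.mem_ofPred_eq, C.color_smul]
    exact hb
  · intro h
    obtain ⟨g, rfl⟩ := MulAction.exists_smul_eq G a x
    refine ⟨g, g⁻¹ • y, ?_, by rw [smul_inv_smul]⟩
    rw [suborbit, Set.mem_ofPred_eq, ← C.color_smul g, smul_inv_smul]
    exact h

theorem isPaired_suborbit_iff (a : Ω) (i j : Fin 4) :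
    IsPaired G a (C.suborbit a i) (C.suborbit a j) ↔ j = C.inv i := by
  rw [IsPaired, C.orbital_suborbit, C.orbital_suborbit]
  constructor
  · intro h
    obtain ⟨x, y, hxy⟩ := C.exists_color j
    have : (x, y) ∈ {x | (x.2, x.1) ∈ {x : Ω × Ω | C.color x.1 x.2 = i}} := h ▸ hxy
    rw [← hxy, ← (this : C.color y x = i), C.color_swap]
  · rintro rfl
    ext ⟨x, y⟩
    exact C.color_swap_eq_iff

theorem ncard_suborbit [Fintype Ω] (a : Ω) (i : Fin 4) :
    (C.suborbit a i).ncard = C.degAt a i := by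
  rw [degAt, ← Set.ncard_coe_finset]
  congr 1
  ext b
  simp [suborbit]

end Coloring

end PrimitiveDegreeThreeP

/-! ### The classification -/

open PrimitiveDegreeThreeP in
theorem theorem9p2 {Ω : Type*} [Fintype Ω] (p : ℕ) (hp : p.Prime) (hp5 : 5 ≤ p)
    (hΩ : Fintype.card Ω = 3 * p)
    (G : Subgroup (Equiv.Perm Ω)) (hprim : MulAction.IsPreprimitive G Ω)
    (hIV : PrimitiveDegreeThreeP.IsTypeIV G p) (α : Ω) :
    ∃ a : ℕ, p = 3 * a ^ 2 + 3 * a + 1 ∧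
      ∃ Δ : Fin 4 → Set Ω, Function.Injective Δ ∧
        Set.range Δ = PrimitiveDegreeThreeP.suborbits G α ∧ Δ 0 = {α} ∧
        ((∃ i j, i ≠ j ∧ PrimitiveDegreeThreeP.IsPaired G α (Δ i) (Δ j)) →
          PrimitiveDegreeThreeP.IsPaired G α (Δ 2) (Δ 3) ∧
          ((Even a ∧ ((Δ 1).ncard : ℤ) = p - 2 * a - 1 ∧
              ((Δ 2).ncard : ℤ) = p + a ∧ ((Δ 3).ncard : ℤ) = p + a) ∨
            (Odd a ∧ ((Δ 1).ncard : ℤ) = p + 2 * a + 1 ∧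
              ((Δ 2).ncard : ℤ) = p - a - 1 ∧ ((Δ 3).ncard : ℤ) = p - a - 1))) ∧
        ((¬ ∃ i j, i ≠ j ∧ PrimitiveDegreeThreeP.IsPaired G α (Δ i) (Δ j)) →
          (∀ i, PrimitiveDegreeThreeP.IsPaired G α (Δ i) (Δ i)) ∧
          Even a ∧ ((Δ 1).ncard : ℤ) = p + 2 * a + 1 ∧
            ((Δ 2).ncard : ℤ) = p - a - 1 ∧ ((Δ 3).ncard : ℤ) = p - a - 1) := by
  classical
  have : Nonempty Ω := ⟨α⟩
  obtain ⟨S⟩ := hIV.nonempty_spectrum (by omega)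
  obtain ⟨C₀⟩ := nonempty_coloring (hIV.card_orbits (by omega))
  obtain ⟨C, hC⟩ := C₀.exists_inv_eq
  obtain ⟨P, hP⟩ := exists_parameters S C (by omega) hΩ α
  rcases hC with hC | ⟨h1, h2⟩
  · exact (P.false_of_inv_eq hp5 (hp.odd_of_ne_two (by omega)) hC).elim
  obtain ⟨a, hpa, h⟩ := P.exists_eq_of_inv_swap hp5 h1 h2
  have h23 : IsPaired G α (C.suborbit α 2) (C.suborbit α 3) :=
    (C.isPaired_suborbit_iff α 2 3).2 h2.symm
  -- Only the paired case survives, so the second implication is discharged by the pair 2, 3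
  -- contradicting its premise.
  refine ⟨a, hpa, C.suborbit α, C.suborbit_injective α, C.range_suborbit α, C.suborbit_zero α,
    fun _ => ⟨h23, ?_⟩, fun hne => (hne ⟨2, 3, by decide, h23⟩).elim⟩
  simpa only [C.ncard_suborbit, hP] using h
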